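/- **Notation.** Let $d\ge 3$; all functions are real-valued functions on $\mathbb R^d$, $\langle g\rangle=\int_{\mathbb R^d}g\,dx$, and $W^{1,2}=W^{1,2}(\mathbb R^d)$. For constants $\kappa,c\in\mathbb R$ we write - $b\in\mathbf F_\kappa$ with constant $c$, for a Borel vector field $b\in[L^2_{\rm loc}]^d$, if $\|b\varphi\|_2^2\le\kappa\|\nabla\varphi\|_2^2+c\|\varphi\|_2^2$ for all $\varphi\in W^{1,2}$; - $b\in\mathbf{MF}_\kappa$ with constant $c$, for a vector field $b\in[L^1_{\rm loc}]^d$, if $\langle|b|\varphi^2\rangle\le\kappa\|\nabla\varphi\|_2\|\varphi\|_2+c\|\varphi\|_2^2$ for all $\varphi\in W^{1,2}$; - $q^{1/2}\in\mathbf F_\kappa$ with constant $c$, for a function $0\le q\in L^1_{\rm loc}$, if $\langle q\varphi^2\rangle\le\kappa\|\nabla\varphi\|_2^2+c\|\varphi\|_2^2$ for all $\varphi\in W^{1,2}$. **Theorem 5.1 (Hölder continuity of solutions).** Let $b:\mathbb R^d\to\mathbb R^d$ be a bounded smooth vector field such that either 1. $b\in\mathbf F_\delta$ with constant $c_\delta$,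 where $\delta<4$; or 2. $b\in\mathbf{MF}_{\kappa}$ with constant $c_{\kappa}$ (where $\kappa<\infty$ is arbitrary), and $\mathrm{div}\,b=\mathrm{div}\,b_+-\mathrm{div}\,b_-$ for some bounded smooth functions $\mathrm{div}\,b_\pm\ge0$ (not necessarily the positive and negative parts of $\mathrm{div}\,b$) such that $(\mathrm{div}\,b_+)^{1/2}\in\mathbf F_{\delta_+}$ with constant $c_{\delta_+}$, where $\delta_+<4$. Let $f\in C_c^\infty(\mathbb R^d)$, let $\lambda\ge0$, and let $u\in C^2(\mathbb R^d)$ be a classical solution of $$(\lambda-\Delta+b\cdot\nabla)u=f\quad\text{on }\mathbb R^d .$$ Call a constant *generic* if it depends only on $d$, $\lambda$, an upper bound $A$ for $\|f\|_\infty$, and the form-bounds, i.e. on $\delta,c_\delta$ in case 1 and on $\kappa,c_\kappa,\delta_+,c_{\delta_+}$ in case 2. - If $\lambda>0$ and $u$ is the bounded classical solution, then there are generic constants $\alpha\in(0,1)$ and $C\ge 0$ such that, for every $x_0\in\mathbb R^d$, $$|u(x)-u(y)|\le C|x-y|^\alpha\qquad\text{for all }x,y\in B_1(x_0).$$ - If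 $\lambda=0$, the same estimate holds on $B_1(x_0)$ for every $x_0\in\mathbb R^d$ and every $M$ with $|u|\le M$ on $B_2(x_0)$, with $\alpha\in(0,1)$ and $C\ge 0$ that depend only on $M$ and on the quantities on which generic constants depend. In particular, the constants do not depend on the smoothness or the boundedness of $b$. -/

import Mathlib

open MeasureTheory Metric
open scoped ContDiff NNReal

/-- The Euclidean space of dimension `d`. -/
abbrev Rd (d : ℕ) : Type := EuclideanSpace ℝ (Fin d)

/-- `f` is a smooth compactly supported real function. -/
def IsTestFunction {d : ℕ} (f : Rd d → ℝ) : Prop :=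
  ContDiff ℝ ∞ f ∧ HasCompactSupport f

/-- `g` is smooth, and `g` itself is bounded (nothing is asked of its derivatives). -/
def IsBoundedSmooth {d : ℕ} {V : Type*} [NormedAddCommGroup V] [NormedSpace ℝ V]
    (g : Rd d → V) : Prop :=
  ContDiff ℝ ∞ g ∧ ∃ M : ℝ, ∀ x, ‖g x‖ ≤ M

/-- `φ` belongs to the Sobolev space `W^{1,2}(ℝ^d)` and `G` is its weak gradient. -/
structure IsSobolevWithGradient {d : ℕ} (φ : Rd d → ℝ) (G : Rd d → Rd d) : Prop where
  memLp : MemLp φ 2 volume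
  memLp_grad : MemLp G 2 volume
  weak : ∀ ψ : Rd d → ℝ, IsTestFunction ψ → ∀ i : Fin d,
    (∫ x, φ x * fderiv ℝ ψ x (EuclideanSpace.single i 1)) = - (∫ x, G x i * ψ x)

/-- `b ∈ 𝐅_κ` with additive constant `c`: a Borel field `b ∈ L²_loc` such that
`‖b φ‖₂² ≤ κ ‖∇φ‖₂² + c ‖φ‖₂²` for all `φ ∈ W^{1,2}`, the left-hand side being finite. -/
structure IsFormBounded {d : ℕ} (κ c : ℝ) (b : Rd d → Rd d) : Prop where
  measurable : Measurable b
  locallySqIntegrable : LocallyIntegrable (fun x => ‖b x‖ ^ 2) volume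
  bound : ∀ (φ : Rd d → ℝ) (G : Rd d → Rd d), IsSobolevWithGradient φ G →
    Integrable (fun x => ‖b x‖ ^ 2 * φ x ^ 2) volume ∧
    (∫ x, ‖b x‖ ^ 2 * φ x ^ 2) ≤ κ * (∫ x, ‖G x‖ ^ 2) + c * (∫ x, φ x ^ 2)

/-- `b ∈ 𝐌𝐅_κ` with additive constant `c`: a field `b ∈ L¹_loc` such that
`⟨|b| φ, φ⟩ ≤ κ ‖∇φ‖₂ ‖φ‖₂ + c ‖φ‖₂²` for all `φ ∈ W^{1,2}`, the left-hand side being finite. -/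
structure IsMulFormBounded {d : ℕ} (κ c : ℝ) (b : Rd d → Rd d) : Prop where
  locallyIntegrable : LocallyIntegrable b volume
  bound : ∀ (φ : Rd d → ℝ) (G : Rd d → Rd d), IsSobolevWithGradient φ G →
    Integrable (fun x => ‖b x‖ * φ x ^ 2) volume ∧
    (∫ x, ‖b x‖ * φ x ^ 2) ≤
      κ * (√(∫ x, ‖G x‖ ^ 2) * √(∫ x, φ x ^ 2)) + c * (∫ x, φ x ^ 2)

/-- `q^{1/2} ∈ 𝐅_κ` with additive constant `c`, for a scalar potential `q` (used for `q ≥ 0`):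
`q ∈ L¹_loc` and `⟨q φ, φ⟩ ≤ κ ‖∇φ‖₂² + c ‖φ‖₂²` for all `φ ∈ W^{1,2}`,
the left-hand side being finite. -/
structure IsPotentialFormBounded {d : ℕ} (κ c : ℝ) (q : Rd d → ℝ) : Prop where
  locallyIntegrable : LocallyIntegrable q volume
  bound : ∀ (φ : Rd d → ℝ) (G : Rd d → Rd d), IsSobolevWithGradient φ G →
    Integrable (fun x => q x * φ x ^ 2) volume ∧
    (∫ x, q x * φ x ^ 2) ≤ κ * (∫ x, ‖G x‖ ^ 2) + c * (∫ x, φ x ^ 2)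

/-- The divergence of a vector field. -/
noncomputable def divergence {d : ℕ} (b : Rd d → Rd d) (x : Rd d) : ℝ :=
  ∑ i : Fin d, fderiv ℝ b x (EuclideanSpace.single i 1) i

/-- `div b = q₊ - q₋` for some bounded smooth functions `q₊, q₋ ≥ 0` (not necessarily the positive
and negative parts of `div b`) such that `q₊^{1/2} ∈ 𝐅_κ` with additive constant `c`. -/
def HasFormBoundedDivPlus {d : ℕ} (κ c : ℝ) (b : Rd d → Rd d) : Prop :=
  ∃ qp qm : Rd d → ℝ, IsBoundedSmooth qp ∧ IsBoundedSmooth qm ∧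
    (∀ x, 0 ≤ qp x) ∧ (∀ x, 0 ≤ qm x) ∧ (∀ x, divergence b x = qp x - qm x) ∧
    IsPotentialFormBounded κ c qp

/-- `u` is a classical (twice continuously differentiable) solution of
`(lam - Δ + b ⋅ ∇) u = f` on `ℝ^d`. -/
def IsClassicalSolution {d : ℕ} (lam : ℝ) (b : Rd d → Rd d) (f u : Rd d → ℝ) : Prop :=
  ContDiff ℝ 2 u ∧
    ∀ x, lam * u x - Laplacian.laplacian u x + inner ℝ (b x) (gradient u x) = f x

/-- Local Hölder continuity of the classical solutions of `(lam - Δ + b ⋅ ∇) u = f`, with an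
exponent `α` and a constant `C` that are the same for all bounded smooth `b` in the class `P`, for
all `f ∈ C_c^∞` with `‖f‖_∞ ≤ A`, and for all unit balls.
For `lam > 0` the solution is the bounded one. For `lam = 0` the equation determines a solution at
most up to an additive constant and gives no bound on its size, so any classical solution is
allowed and the constants depend also on a bound `M` for `|u|` on the concentric ball of
radius `2`. -/
def HolderWithGenericConstants (d : ℕ) (lam A : ℝ) (P : (Rd d → Rd d) → Prop) : Prop :=
  (0 < lam → ∃ α C : ℝ≥0, 0 < α ∧ α < 1 ∧
    ∀ (b : Rd d → Rd d) (f u : Rd d → ℝ), IsBoundedSmooth b → P b →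
      IsTestFunction f → (∀ x, |f x| ≤ A) →
      IsClassicalSolution lam b f u → (∃ M : ℝ, ∀ x, |u x| ≤ M) →
      ∀ x₀ : Rd d, HolderOnWith C α u (ball x₀ 1)) ∧
  (lam = 0 → ∀ M : ℝ, ∃ α C : ℝ≥0, 0 < α ∧ α < 1 ∧
    ∀ (b : Rd d → Rd d) (f u : Rd d → ℝ), IsBoundedSmooth b → P b →
      IsTestFunction f → (∀ x, |f x| ≤ A) →
      IsClassicalSolution lam b f u →
      ∀ x₀ : Rd d, (∀ x ∈ ball x₀ 2, |u x| ≤ M) → HolderOnWith C α u (ball x₀ 1))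

/-!
The proof is De Giorgi's, run on powers of truncations instead of the truncations themselves.

Write the equation as `-Δu + b ⋅ ∇u = g`. The source `g` is bounded: it is `f` when `λ = 0`, and
`f - λ u` when `λ > 0`, where `λ |u| ≤ ‖f‖_∞` by the maximum principle (`mul_le_of_bounded`).
Put `w = (u - k)₊ ^ m` and test the equation against `(u - k)₊ ^ (2 m - 1) η²`. This leaves the
energy `∫ η² |∇w|²` with the coefficient `2 - 1 / m`, against which the drift contributes at most
`√δ` times the energy if `b` is form-bounded (`energy_le_of_isFormBounded`), and at most `δ₊ / 2`
times the energy if the drift is integrated by parts and the positive part of the divergence is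
form-bounded (`energy_le_of_divergence`). Either quantity is smaller than `2`, so a large `m` makes
the energy win; this is the only place where the size of the form bounds matters. In the second
case a term `∫ |b| |∇η| η w²` is left over. The multiplicative form bound estimates it by a small
fraction of the energy on a larger ball, which is absorbed by varying the radius
(`le_of_le_half_add`). In both cases the outcome is the Caccioppoli inequality
`SatisfiesCaccioppoli`, whose constant is generic, and nothing else about `b` is used afterwards.
Taking `m ≥ 2` an integer keeps all test functions of class `C¹`.

A function satisfying this inequality together with its negative is Hölder continuous:

* `exists_degiorgi_small_superlevel`: if `u` exceeds a level only on a small part of a ball, then it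
  stays below a slightly higher level on the ball of half the radius. This iterates the Caccioppoli
  inequality with a Faber-Krahn inequality, which comes from the `L¹` Sobolev inequality;
* `exists_degiorgi_shrinking`: if `u` stays away from its maximum on half of a ball, then the part of
  the ball where `u` is very close to its maximum is as small as desired. On each of the dyadic level
  strips, a Poincaré inequality for functions vanishing on half of a ball estimates the measure of
  the last superlevel set by the measure of the strip, and the strips are disjoint.

Applied to `u` or to `-u`, these lemmas reduce the oscillation by a fixed factor when the radius is
divided by four (`exists_osc_decay`), and iterating this gives the Hölder estimate.
-/

/-! ### Powers of the positive part -/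

section PositivePowers

theorem hasDerivAt_max_pow (n : ℕ) (s : ℝ) :
    HasDerivAt (fun t : ℝ => max t 0 ^ (n + 2)) ((n + 2) * max s 0 ^ (n + 1)) s := by
  rcases lt_trichotomy s 0 with hs | rfl | hs
  · have h : (fun t : ℝ => max t 0 ^ (n + 2)) =ᶠ[nhds s] fun _ => 0 := by
      filter_upwards [Iio_mem_nhds hs] with t ht
      simp [max_eq_right (Set.mem_Iio.1 ht).le]
    simpa [max_eq_right hs.le] using (hasDerivAt_const s (0 : ℝ)).congr_of_eventuallyEq h
  · rw [hasDerivAt_iff_isLittleO]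
    have h1 : (fun t : ℝ => max t 0 ^ (n + 2)) =O[nhds 0] fun t => t ^ (n + 2) := by
      refine Asymptotics.IsBigO.of_bound 1 (Filter.Eventually.of_forall fun t => ?_)
      rw [norm_pow, norm_pow, one_mul]
      refine pow_le_pow_left₀ (norm_nonneg _) ?_ _
      rcases le_total t 0 with h | h <;> simp [h]
    have h2 : (fun t : ℝ => t ^ (n + 2)) =o[nhds 0] fun t => t := by
      simpa using Asymptotics.isLittleO_pow_pow (𝕜 := ℝ) (m := 1) (n := n + 2) (by omega)
    simpa using h1.trans_isLittleO h2
  · have h : (fun t : ℝ => max t 0 ^ (n + 2)) =ᶠ[nhds s] fun t => t ^ (n + 2) := by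
      filter_upwards [Ioi_mem_nhds hs] with t ht
      simp [max_eq_left (Set.mem_Ioi.1 ht).le]
    have h3 := (hasDerivAt_pow (n + 2) s).congr_of_eventuallyEq h
    simpa [max_eq_left hs.le] using h3

theorem contDiff_max_pow (n : ℕ) : ContDiff ℝ 1 (fun t : ℝ => max t 0 ^ (n + 2)) := by
  rw [contDiff_one_iff_deriv]
  refine ⟨fun s => (hasDerivAt_max_pow n s).differentiableAt, ?_⟩
  rw [funext fun s => (hasDerivAt_max_pow n s).deriv]
  fun_prop

end PositivePowers

/-! ### Gradients and divergences -/

section GradientCalculus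

variable {d : ℕ}

theorem gradient_mul_apply {f g : Rd d → ℝ} {x : Rd d} (hf : DifferentiableAt ℝ f x)
    (hg : DifferentiableAt ℝ g x) :
    gradient (fun y => f y * g y) x = f x • gradient g x + g x • gradient f x := by
  simp only [gradient]
  rw [fderiv_fun_mul hf hg, map_add, map_smul, map_smul]

theorem gradient_comp_apply {h : ℝ → ℝ} {h' : ℝ} {f : Rd d → ℝ} {x : Rd d}
    (hh : HasDerivAt h h' (f x)) (hf : DifferentiableAt ℝ f x) :
    gradient (fun y => h (f y)) x = h' • gradient f x := by
  simp only [gradient]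
  have := (hh.comp_hasFDerivAt x hf.hasFDerivAt).fderiv
  rw [show (fun y => h (f y)) = h ∘ f from rfl, this, map_smul]

theorem norm_gradient_eq (f : Rd d → ℝ) (x : Rd d) : ‖gradient f x‖ = ‖fderiv ℝ f x‖ := by
  simp [gradient]

theorem inner_gradient_eq_fderiv (f : Rd d → ℝ) (x y : Rd d) :
    inner ℝ y (gradient f x) = fderiv ℝ f x y := by
  rw [real_inner_comm]; simp [gradient]

theorem gradient_apply_eq (f : Rd d → ℝ) (x : Rd d) (i : Fin d) :
    gradient f x i = fderiv ℝ f x (EuclideanSpace.single i 1) := by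
  rw [← inner_gradient_eq_fderiv, EuclideanSpace.inner_single_left]; simp

theorem contDiff_gradient {n m : WithTop ℕ∞} {f : Rd d → ℝ} (hf : ContDiff ℝ n f)
    (h : m + 1 ≤ n) : ContDiff ℝ m (gradient f) := by
  have h1 : ContDiff ℝ m (fderiv ℝ f) := hf.fderiv_right h
  exact (InnerProductSpace.toDual ℝ (Rd d)).symm.toContinuousLinearEquiv.contDiff.comp h1

theorem continuous_gradient {f : Rd d → ℝ} (hf : ContDiff ℝ 1 f) : Continuous (gradient f) :=
  (contDiff_gradient (m := 0) hf (by simp)).continuous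

theorem HasCompactSupport.gradient {f : Rd d → ℝ} (hf : HasCompactSupport f) :
    HasCompactSupport (gradient f) :=
  (hf.fderiv ℝ).comp_left (g := (InnerProductSpace.toDual ℝ (Rd d)).symm) (map_zero _)

theorem divergence_eq_sum_fderiv_apply {b : Rd d → Rd d} {x : Rd d} (hb : DifferentiableAt ℝ b x) :
    divergence b x = ∑ i, fderiv ℝ (fun y => b y i) x (EuclideanSpace.single i 1) := by
  unfold divergence
  refine Finset.sum_congr rfl fun i _ => ?_
  have := ((EuclideanSpace.proj i : Rd d →L[ℝ] ℝ).hasFDerivAt.comp x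
    hb.hasFDerivAt).fderiv
  rw [show (fun y => b y i) = (EuclideanSpace.proj i : Rd d →L[ℝ] ℝ) ∘ b
    from rfl, this]
  rfl

theorem divergence_gradient {u : Rd d → ℝ} (hu : ContDiff ℝ 2 u) (x : Rd d) :
    divergence (gradient u) x = Laplacian.laplacian u x := by
  have hg : DifferentiableAt ℝ (gradient u) x :=
    ((contDiff_gradient (m := 1) hu (by norm_num)).differentiable (by norm_num)) x
  rw [divergence_eq_sum_fderiv_apply hg,
    InnerProductSpace.laplacian_eq_iteratedFDeriv_orthonormalBasis u
      (EuclideanSpace.basisFun (Fin d) ℝ), ]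
  refine Finset.sum_congr rfl fun i _ => ?_
  simp only [EuclideanSpace.basisFun_apply]
  rw [iteratedFDeriv_two_apply]
  simp only [gradient_apply_eq]
  have h2 : DifferentiableAt ℝ (fderiv ℝ u) x :=
    ((hu.fderiv_right (m := 1) (by norm_num)).differentiable (by norm_num)) x
  rw [fderiv_clm_apply h2 (by fun_prop)]
  simp

end GradientCalculus

/-! ### Integration by parts -/

section IntegrationByParts

variable {d : ℕ}

theorem integral_inner_gradient_eq {b : Rd d → Rd d} {ψ : Rd d → ℝ} (hb : ContDiff ℝ 1 b)
    (hψ : ContDiff ℝ 1 ψ) (hc : HasCompactSupport ψ) :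
    ∫ x, inner ℝ (b x) (gradient ψ x) = -∫ x, divergence b x * ψ x := by
  have hbi : ∀ i, ContDiff ℝ 1 (fun y => b y i) := fun i =>
    (EuclideanSpace.proj i : Rd d →L[ℝ] ℝ).contDiff.comp hb
  have hd : ∀ x, divergence b x * ψ x =
      ∑ i, fderiv ℝ (fun y => b y i) x (EuclideanSpace.single i 1) * ψ x := fun x => by
    rw [divergence_eq_sum_fderiv_apply (hb.differentiable (by norm_num) x), Finset.sum_mul]
  have hi : ∀ x, inner ℝ (b x) (gradient ψ x) =
      ∑ i, b x i * fderiv ℝ ψ x (EuclideanSpace.single i 1) := fun x => by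
    rw [PiLp.inner_apply]
    refine Finset.sum_congr rfl fun i _ => ?_
    rw [gradient_apply_eq]; simp [mul_comm]
  have hcf : ∀ i, Continuous fun x => fderiv ℝ ψ x (EuclideanSpace.single i 1) := fun i =>
    (hψ.continuous_fderiv (by norm_num)).clm_apply continuous_const
  have hcb : ∀ i, Continuous fun x => fderiv ℝ (fun y => b y i) x (EuclideanSpace.single i 1) :=
    fun i => ((hbi i).continuous_fderiv (by norm_num)).clm_apply continuous_const
  have hsf : ∀ i : Fin d, HasCompactSupport
      fun x => fderiv ℝ ψ x (EuclideanSpace.single i 1) := fun i =>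
    hc.fderiv_apply ℝ _
  have I1 : ∀ i, Integrable (fun x => b x i * fderiv ℝ ψ x (EuclideanSpace.single i 1)) := fun i =>
    ((hbi i).continuous.mul (hcf i)).integrable_of_hasCompactSupport (hsf i).mul_left
  have I2 : ∀ i, Integrable
      (fun x => fderiv ℝ (fun y => b y i) x (EuclideanSpace.single i 1) * ψ x) := fun i =>
    ((hcb i).mul hψ.continuous).integrable_of_hasCompactSupport hc.mul_left
  simp only [hd, hi]
  rw [integral_finsetSum _ fun i _ => I1 i, integral_finsetSum _ fun i _ => I2 i,
    ← Finset.sum_neg_distrib]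
  refine Finset.sum_congr rfl fun i _ => ?_
  exact integral_mul_fderiv_eq_neg_fderiv_mul_of_integrable (I2 i) (I1 i)
    (((hbi i).continuous.mul hψ.continuous).integrable_of_hasCompactSupport hc.mul_left)
    (fun x _ => (hbi i).differentiable (by norm_num) x)
    (fun x _ => hψ.differentiable (by norm_num) x)

theorem isSobolevWithGradient_of_contDiff {φ : Rd d → ℝ} (hφ : ContDiff ℝ 1 φ)
    (hc : HasCompactSupport φ) : IsSobolevWithGradient φ (gradient φ) where
  memLp := hφ.continuous.memLp_of_hasCompactSupport hc
  memLp_grad := (continuous_gradient hφ).memLp_of_hasCompactSupport hc.gradient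
  weak ψ hψ i := by
    have h1 : ContDiff ℝ 1 ψ := hψ.1.of_le (by exact_mod_cast le_top)
    simp only [gradient_apply_eq]
    have hcf : ∀ {f : Rd d → ℝ}, ContDiff ℝ 1 f → Continuous fun x =>
      fderiv ℝ f x (EuclideanSpace.single i 1) := fun hf =>
      (hf.continuous_fderiv (by norm_num)).clm_apply continuous_const
    exact integral_mul_fderiv_eq_neg_fderiv_mul_of_integrable
      (((hcf hφ).mul h1.continuous).integrable_of_hasCompactSupport hψ.2.mul_left)
      ((hφ.continuous.mul (hcf h1)).integrable_of_hasCompactSupport hc.mul_right)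
      ((hφ.continuous.mul h1.continuous).integrable_of_hasCompactSupport hc.mul_right)
      (fun x _ => hφ.differentiable (by norm_num) x)
      (fun x _ => h1.differentiable (by norm_num) x)

end IntegrationByParts

/-! ### Cutoff functions -/

section Cutoff

theorem exists_bound_deriv_smoothTransition :
    ∃ L : ℝ, 1 ≤ L ∧ ∀ s, |deriv Real.smoothTransition s| ≤ L := by
  have hc : Continuous (deriv Real.smoothTransition) :=
    (Real.smoothTransition.contDiff (n := 1)).continuous_deriv (by norm_num)
  obtain ⟨L, hL⟩ := isCompact_Icc.exists_bound_of_continuousOn (s := Set.Icc (0:ℝ) 1) hc.continuousOn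
  refine ⟨max L 1, le_max_right _ _, fun s => ?_⟩
  by_cases hs : s ∈ Set.Icc (0:ℝ) 1
  · exact (hL s hs).trans (le_max_left _ _)
  · have h0 : deriv Real.smoothTransition s = 0 := by
      simp only [Set.mem_Icc, not_and_or, not_le] at hs
      rcases hs with hs | hs
      · have : Real.smoothTransition =ᶠ[nhds s] fun _ => 0 := by
          filter_upwards [Iio_mem_nhds hs] with t ht
          exact Real.smoothTransition.zero_of_nonpos (le_of_lt ht)
        rw [this.deriv_eq]; simp
      · have : Real.smoothTransition =ᶠ[nhds s] fun _ => 1 := by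
          filter_upwards [Ioi_mem_nhds hs] with t ht
          exact Real.smoothTransition.one_of_one_le (le_of_lt ht)
        rw [this.deriv_eq]; simp
    rw [h0, abs_zero]; positivity

theorem deriv_smoothTransition_eq_zero {s : ℝ} (hs : s ≤ 0 ∨ 1 ≤ s) :
    deriv Real.smoothTransition s = 0 := by
  rcases hs with hs | hs
  · refine IsLocalMin.deriv_eq_zero (Filter.Eventually.of_forall fun t => ?_)
    rw [Real.smoothTransition.zero_of_nonpos hs]; exact Real.smoothTransition.nonneg t
  · refine IsLocalMax.deriv_eq_zero (Filter.Eventually.of_forall fun t => ?_)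
    rw [Real.smoothTransition.one_of_one_le hs]; exact Real.smoothTransition.le_one t

variable {d : ℕ}

/-- `η` is a `C¹` cutoff function between the concentric balls of radii `r < R` around `x₀`: it takes
values in `[0, 1]`, equals `1` on the smaller ball and `0` off the larger one, and its gradient is at
most `L / (R - r)`. -/
structure IsCutoff (L : ℝ) (x₀ : Rd d) (r R : ℝ) (η : Rd d → ℝ) : Prop where
  contDiff : ContDiff ℝ 1 η
  nonneg : ∀ x, 0 ≤ η x
  le_one : ∀ x, η x ≤ 1
  eq_one : ∀ x ∈ ball x₀ r, η x = 1
  eq_zero : ∀ x ∉ ball x₀ R, η x = 0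
  grad_le : ∀ x, ‖gradient η x‖ ≤ L / (R - r)
  grad_eq_zero : ∀ x ∉ ball x₀ R, gradient η x = 0
  hasCompactSupport : HasCompactSupport η

/-- Cutoff functions exist with one constant `L` for all pairs of concentric balls: compose a smooth
step function with the quadratic polynomial `(R² - ‖x - x₀‖²) / (R² - r²)`. -/
theorem exists_cutoff (d : ℕ) : ∃ L : ℝ, 1 ≤ L ∧ ∀ (x₀ : Rd d) (r R : ℝ), 0 < r → r < R →
    ∃ η : Rd d → ℝ, IsCutoff L x₀ r R η := by
  obtain ⟨L, hL1, hL⟩ := exists_bound_deriv_smoothTransition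
  refine ⟨2 * L, by linarith, fun x₀ r R hr hrR => ?_⟩
  have hD : 0 < R ^ 2 - r ^ 2 := by nlinarith
  set q : Rd d → ℝ := fun x => (R ^ 2 - ‖x - x₀‖ ^ 2) / (R ^ 2 - r ^ 2) with hq
  have hqc : ContDiff ℝ 1 q :=
    (contDiff_const.sub ((contDiff_id.sub contDiff_const).norm_sq ℝ)).div_const _
  have hqz : ∀ x ∉ ball x₀ R, q x ≤ 0 := fun x hx => by
    rw [mem_ball_iff_norm, not_lt] at hx
    exact div_nonpos_of_nonpos_of_nonneg (by nlinarith) hD.le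
  have hq1 : ∀ x ∈ ball x₀ r, 1 ≤ q x := fun x hx => by
    rw [mem_ball_iff_norm] at hx
    rw [hq, le_div_iff₀ hD]
    nlinarith [norm_nonneg (x - x₀)]
  have hz : ∀ x ∉ ball x₀ R, Real.smoothTransition (q x) = 0 := fun x hx =>
    Real.smoothTransition.zero_of_nonpos (hqz x hx)
  have hg : ∀ x, gradient (fun y => Real.smoothTransition (q y)) x =
      deriv Real.smoothTransition (q x) • gradient q x := fun x =>
    gradient_comp_apply ((Real.smoothTransition.contDiff (n := 1)).differentiable (by norm_num)
      (q x)).hasDerivAt (hqc.differentiable (by norm_num) x)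
  have hgz : ∀ x ∉ ball x₀ R, gradient (fun y => Real.smoothTransition (q y)) x = 0 := fun x hx => by
    rw [hg, deriv_smoothTransition_eq_zero (Or.inl (hqz x hx)), zero_smul]
  have hgq : ∀ x, ‖gradient q x‖ ≤ 2 * ‖x - x₀‖ / (R ^ 2 - r ^ 2) := fun x => by
    rw [norm_gradient_eq]
    have h1 : HasFDerivAt (fun y : Rd d => ‖y - x₀‖ ^ 2) ((2 : ℝ) • innerSL ℝ (x - x₀)) x := by
      have := ((hasFDerivAt_id x).sub_const x₀).norm_sq
      refine this.congr_fderiv ?_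
      ext y; simp
    have h2 : HasFDerivAt q ((R ^ 2 - r ^ 2)⁻¹ • (-((2 : ℝ) • innerSL ℝ (x - x₀)))) x := by
      have := (h1.const_sub (R ^ 2)).const_smul ((R ^ 2 - r ^ 2)⁻¹)
      refine this.congr_of_eventuallyEq (Filter.Eventually.of_forall fun y => ?_)
      simp [hq, div_eq_inv_mul]
    rw [h2.fderiv, norm_smul, norm_neg, norm_smul, innerSL_apply_norm]
    rw [norm_inv, Real.norm_of_nonneg hD.le]
    simp [div_eq_inv_mul]
  refine ⟨fun x => Real.smoothTransition (q x), ?_, fun x => Real.smoothTransition.nonneg _,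
    fun x => Real.smoothTransition.le_one _,
    fun x hx => Real.smoothTransition.one_of_one_le (hq1 x hx), hz, ?_, hgz, ?_⟩
  · exact Real.smoothTransition.contDiff.comp hqc
  · intro x
    by_cases hx : x ∈ ball x₀ R
    · rw [hg, norm_smul]
      rw [mem_ball_iff_norm] at hx
      calc _ ≤ L * (2 * ‖x - x₀‖ / (R ^ 2 - r ^ 2)) :=
            mul_le_mul (hL _) (hgq x) (norm_nonneg _) (by linarith)
        _ ≤ 2 * L / (R - r) := by
            rw [mul_div_assoc', div_le_div_iff₀ hD (by linarith)]
            have : ‖x - x₀‖ * (R - r) ≤ R ^ 2 - r ^ 2 := by nlinarith [norm_nonneg (x - x₀)]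
            nlinarith
    · rw [hgz x hx, norm_zero]
      exact div_nonneg (by linarith) (by linarith)
  · refine HasCompactSupport.intro (isCompact_closedBall x₀ R) fun x hx => hz x fun h =>
      hx (ball_subset_closedBall h)

end Cutoff

/-! ### Energy estimates -/

section Energy

variable {d : ℕ}

/-- The excess `(u - k)₊` of `u` over the level `k`. -/
noncomputable def excess (u : Rd d → ℝ) (k : ℝ) (x : Rd d) : ℝ := max (u x - k) 0

theorem excess_nonneg (u : Rd d → ℝ) (k : ℝ) (x : Rd d) : 0 ≤ excess u k x := le_max_right _ _

theorem continuous_excess {u : Rd d → ℝ} (hu : Continuous u) (k : ℝ) : Continuous (excess u k) := by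
  unfold excess; fun_prop

theorem contDiff_excess_pow {u : Rd d → ℝ} (hu : ContDiff ℝ 1 u) (k : ℝ) (n : ℕ) :
    ContDiff ℝ 1 (fun x => excess u k x ^ (n + 2)) :=
  (contDiff_max_pow n).comp (hu.sub contDiff_const)

theorem gradient_excess_pow {u : Rd d → ℝ} (hu : ContDiff ℝ 1 u) (k : ℝ) (n : ℕ) (x : Rd d) :
    gradient (fun y => excess u k y ^ (n + 2)) x =
      ((n + 2) * excess u k x ^ (n + 1)) • gradient u x :=
  gradient_comp_apply (h := fun s => max (s - k) 0 ^ (n + 2))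
    ((hasDerivAt_max_pow n (u x - k)).comp_sub_const (u x) k) (hu.differentiable (by norm_num) x)

theorem integrable_of_eq_zero_of_cutoff {f η : Rd d → ℝ} (hf : Continuous f)
    (hη : HasCompactSupport η) (h : ∀ x, η x = 0 → f x = 0) : Integrable f :=
  hf.integrable_of_hasCompactSupport (hη.mono fun x hx hx0 => hx (h x hx0))

theorem continuous_laplacian {u : Rd d → ℝ} (hu : ContDiff ℝ 2 u) :
    Continuous (Laplacian.laplacian u) := by
  rw [InnerProductSpace.laplacian_eq_iteratedFDeriv_orthonormalBasis u
      (EuclideanSpace.basisFun (Fin d) ℝ)]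
  refine continuous_finsetSum _ fun i _ => ?_
  have := hu.continuous_iteratedFDeriv (m := 2) le_rfl
  exact (ContinuousMultilinearMap.apply ℝ (fun _ : Fin 2 => Rd d) ℝ _).continuous.comp this

/-- The source term `-Δu + b ⋅ ∇u`. -/
noncomputable def driftSource (b : Rd d → Rd d) (u : Rd d → ℝ) (x : Rd d) : ℝ :=
  -Laplacian.laplacian u x + inner ℝ (b x) (gradient u x)

theorem continuous_driftSource {b : Rd d → Rd d} {u : Rd d → ℝ} (hb : Continuous b)
    (hu : ContDiff ℝ 2 u) : Continuous (driftSource b u) :=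
  (continuous_laplacian hu).neg.add
    (hb.inner (continuous_gradient (hu.of_le (by norm_num))))

/-- Testing the equation `-Δu + b ⋅ ∇u = g` against `(u - k)₊^(2m-1) η²`, with `m = n + 2`, written
in terms of `w = (u - k)₊^m`. -/
theorem energy_identity {b : Rd d → Rd d} {u η : Rd d → ℝ} (hb : Continuous b)
    (hu : ContDiff ℝ 2 u) (n : ℕ) (k : ℝ) (hη : ContDiff ℝ 1 η) (hc : HasCompactSupport η)
    {w : Rd d → ℝ} (hw : w = fun x => excess u k x ^ (n + 2)) :
    (2 - 1 / (n + 2 : ℝ)) * (∫ x, η x ^ 2 * ‖gradient w x‖ ^ 2)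
      + 2 * (∫ x, η x * w x * inner ℝ (gradient w x) (gradient η x))
      + (∫ x, w x * η x ^ 2 * inner ℝ (b x) (gradient w x))
    = (n + 2) * ∫ x, driftSource b u x * (excess u k x ^ (2 * n + 3) * η x ^ 2) := by
  have hu1 : ContDiff ℝ 1 u := hu.of_le (by norm_num)
  have hwc : ContDiff ℝ 1 w := hw ▸ contDiff_excess_pow hu1 k n
  have hgw := continuous_gradient hwc
  have hgη := continuous_gradient hη
  have hgu := continuous_gradient hu1
  have hec := continuous_excess hu1.continuous k
  have hηc := hη.continuous
  have hwcc := hwc.continuous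
  have hΔ := continuous_laplacian hu
  set φ : Rd d → ℝ := fun x => excess u k x ^ (2 * n + 1 + 2) * (η x * η x) with hφ
  have hφ1 : ContDiff ℝ 1 φ := (contDiff_excess_pow hu1 k (2 * n + 1)).mul (hη.mul hη)
  have hφc : HasCompactSupport φ := hc.mono fun x hx h0 => hx (by simp [hφ, h0])
  have green := integral_inner_gradient_eq (contDiff_gradient (m := 1) hu (by norm_num)) hφ1 hφc
  simp only [divergence_gradient hu] at green
  have hgφ : ∀ x, gradient φ x = (excess u k x ^ (2 * n + 1 + 2) * (2 * η x)) • gradient η x +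
      (η x ^ 2 * ((2 * n + 3) * excess u k x ^ (2 * n + 2))) • gradient u x := fun x => by
    have hdη := hη.differentiable (by norm_num) x
    rw [hφ, gradient_mul_apply (g := fun y => η y * η y)
      ((contDiff_excess_pow hu1 k (2 * n + 1)).differentiable (by norm_num) x) (hdη.mul hdη), gradient_mul_apply hdη hdη, gradient_excess_pow hu1 k]
    push_cast
    simp only [smul_smul, ← add_smul]
    congr 2 <;> ring
  have hcn : ((n : ℝ) + 2) ≠ 0 := by positivity
  have key : ∀ x, (n + 2) * inner ℝ (gradient u x) (gradient φ x) =
      (2 - 1 / (n + 2 : ℝ)) * (η x ^ 2 * ‖gradient w x‖ ^ 2) +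
        2 * (η x * w x * inner ℝ (gradient w x) (gradient η x)) := fun x => by
    have h1 : gradient w x = ((n + 2) * excess u k x ^ (n + 1)) • gradient u x := by
      rw [hw, gradient_excess_pow hu1]
    rw [hgφ, h1, inner_add_right, inner_smul_right, inner_smul_right, inner_smul_left, norm_smul,
      mul_pow, Real.norm_eq_abs, sq_abs, real_inner_self_eq_norm_sq, hw]
    simp only [conj_trivial]
    field_simp
    ring
  have hI : ∀ {f : Rd d → ℝ}, Continuous f → (∀ x, η x = 0 → f x = 0) → Integrable f :=
    fun hf h => integrable_of_eq_zero_of_cutoff hf hc h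
  have I1 : Integrable fun x => η x ^ 2 * ‖gradient w x‖ ^ 2 :=
    hI (by fun_prop) fun x hx => by simp [hx]
  have I2 : Integrable fun x => η x * w x * inner ℝ (gradient w x) (gradient η x) :=
    hI (by fun_prop) fun x hx => by simp [hx]
  have I3 : Integrable fun x => w x * η x ^ 2 * inner ℝ (b x) (gradient w x) :=
    hI (by fun_prop) fun x hx => by simp [hx]
  have I4 : Integrable fun x => Laplacian.laplacian u x * φ x :=
    hI (hΔ.mul hφ1.continuous) fun x hx => by simp [hφ, hx]
  have key2 : ∀ x, (n + 2) * (driftSource b u x * (excess u k x ^ (2 * n + 3) * η x ^ 2)) =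
      -((n + 2) * (Laplacian.laplacian u x * φ x)) +
        w x * η x ^ 2 * inner ℝ (b x) (gradient w x) := fun x => by
    rw [hw, gradient_excess_pow hu1, inner_smul_right, driftSource]
    simp only [hφ]
    ring
  have I5 : Integrable fun x => -((n + 2 : ℝ) * (Laplacian.laplacian u x * φ x)) :=
    (I4.const_mul _).neg
  have hgreen : -((n + 2 : ℝ) * ∫ x, Laplacian.laplacian u x * φ x) =
      (2 - 1 / (n + 2 : ℝ)) * (∫ x, η x ^ 2 * ‖gradient w x‖ ^ 2)
        + 2 * (∫ x, η x * w x * inner ℝ (gradient w x) (gradient η x)) := by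
    rw [← mul_neg, ← green, ← integral_const_mul,
      integral_congr_ae (Filter.Eventually.of_forall key),
      integral_add (I1.const_mul _) (I2.const_mul _), integral_const_mul, integral_const_mul]
  rw [← integral_const_mul (n + 2 : ℝ) (fun x => driftSource b u x * _),
    integral_congr_ae (Filter.Eventually.of_forall key2), integral_add I5 I3, integral_neg,
    integral_const_mul, hgreen]

section CutoffProduct

variable {w η : Rd d → ℝ}

theorem norm_gradient_mul_sq (hw : ContDiff ℝ 1 w) (hη : ContDiff ℝ 1 η) (x : Rd d) :
    ‖gradient (fun y => w y * η y) x‖ ^ 2 = η x ^ 2 * ‖gradient w x‖ ^ 2 +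
      2 * (η x * w x * inner ℝ (gradient w x) (gradient η x)) + w x ^ 2 * ‖gradient η x‖ ^ 2 := by
  rw [gradient_mul_apply (hw.differentiable (by norm_num) x) (hη.differentiable (by norm_num) x),
    norm_add_sq_real, norm_smul, norm_smul, inner_smul_left, inner_smul_right, mul_pow, mul_pow,
    Real.norm_eq_abs, Real.norm_eq_abs, sq_abs, sq_abs, real_inner_comm]
  simp only [conj_trivial]
  ring

theorem integral_norm_gradient_mul_sq (hw : ContDiff ℝ 1 w) (hη : ContDiff ℝ 1 η)
    (hc : HasCompactSupport η) :
    ∫ x, ‖gradient (fun y => w y * η y) x‖ ^ 2 = (∫ x, η x ^ 2 * ‖gradient w x‖ ^ 2) +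
      2 * (∫ x, η x * w x * inner ℝ (gradient w x) (gradient η x)) +
      ∫ x, w x ^ 2 * ‖gradient η x‖ ^ 2 := by
  have hgw := continuous_gradient hw
  have hgη := continuous_gradient hη
  have hwc := hw.continuous
  have hηc := hη.continuous
  have I1 : Integrable fun x => η x ^ 2 * ‖gradient w x‖ ^ 2 :=
    integrable_of_eq_zero_of_cutoff (by fun_prop) hc fun x hx => by simp [hx]
  have I2 : Integrable fun x => η x * w x * inner ℝ (gradient w x) (gradient η x) :=
    integrable_of_eq_zero_of_cutoff (by fun_prop) hc fun x hx => by simp [hx]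
  have I3 : Integrable fun x => w x ^ 2 * ‖gradient η x‖ ^ 2 :=
    Continuous.integrable_of_hasCompactSupport (by fun_prop)
      (hc.gradient.mono fun x hx h0 => hx (by simp [h0]))
  have I4 : Integrable fun x => η x ^ 2 * ‖gradient w x‖ ^ 2 +
      2 * (η x * w x * inner ℝ (gradient w x) (gradient η x)) := I1.add (I2.const_mul 2)
  rw [integral_congr_ae (Filter.Eventually.of_forall (norm_gradient_mul_sq hw hη)),
    integral_add I4 I3, integral_add I1 (I2.const_mul 2),
    integral_const_mul]

theorem abs_integral_cross_le (hw : ContDiff ℝ 1 w) (hη : ContDiff ℝ 1 η)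
    (hc : HasCompactSupport η) {ε : ℝ} (hε : 0 < ε) :
    |∫ x, η x * w x * inner ℝ (gradient w x) (gradient η x)| ≤
      ε * (∫ x, η x ^ 2 * ‖gradient w x‖ ^ 2) +
        1 / (4 * ε) * ∫ x, w x ^ 2 * ‖gradient η x‖ ^ 2 := by
  have hgw := continuous_gradient hw
  have hgη := continuous_gradient hη
  have hwc := hw.continuous
  have hηc := hη.continuous
  have I1 : Integrable fun x => η x ^ 2 * ‖gradient w x‖ ^ 2 :=
    integrable_of_eq_zero_of_cutoff (by fun_prop) hc fun x hx => by simp [hx]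
  have I3 : Integrable fun x => w x ^ 2 * ‖gradient η x‖ ^ 2 :=
    Continuous.integrable_of_hasCompactSupport (by fun_prop)
      (hc.gradient.mono fun x hx h0 => hx (by simp [h0]))
  rw [← integral_const_mul, ← integral_const_mul,
    ← integral_add (I1.const_mul ε) (I3.const_mul (1 / (4 * ε))), ← Real.norm_eq_abs]
  refine norm_integral_le_of_norm_le ((I1.const_mul ε).add (I3.const_mul (1 / (4 * ε))))
    (Filter.Eventually.of_forall fun x => ?_)
  rw [norm_mul, norm_mul, Real.norm_eq_abs, Real.norm_eq_abs, Real.norm_eq_abs]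
  have h1 := abs_real_inner_le_norm (gradient w x) (gradient η x)
  have h2 : |η x| * |w x| * |inner ℝ (gradient w x) (gradient η x)| ≤
      (|η x| * ‖gradient w x‖) * (|w x| * ‖gradient η x‖) := by
    calc _ ≤ |η x| * |w x| * (‖gradient w x‖ * ‖gradient η x‖) := by gcongr
      _ = _ := by ring
  refine h2.trans ?_
  set p := |η x| * ‖gradient w x‖
  set q := |w x| * ‖gradient η x‖
  have hp : η x ^ 2 * ‖gradient w x‖ ^ 2 = p ^ 2 := by simp [p, mul_pow]
  have hq : w x ^ 2 * ‖gradient η x‖ ^ 2 = q ^ 2 := by simp [q, mul_pow]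
  rw [hp, hq]
  have : ε * p ^ 2 + 1 / (4 * ε) * q ^ 2 - p * q = (2 * ε * p - q) ^ 2 / (4 * ε) := by
    field_simp; ring
  have h3 : 0 ≤ (2 * ε * p - q) ^ 2 / (4 * ε) := by positivity
  linarith

end CutoffProduct

/-- The cross term `T` between `∇w` and `∇η` is absorbed by half of the energy `E`. -/
theorem energy_absorption {γ E T N c W X G : ℝ} (hγ : 0 < γ)
    (h : γ * E ≤ 6 * |T| + 2 * N + c * W + X + G)
    (hT : |T| ≤ γ / 12 * E + 1 / (4 * (γ / 12)) * N) :
    γ / 2 * E ≤ (18 / γ + 2) * N + c * W + X + G := by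
  have : 1 / (4 * (γ / 12)) = 3 / γ := by field_simp; norm_num
  rw [this] at hT
  have h2 : 18 / γ * N = 6 * (3 / γ * N) := by ring
  linarith

theorem integral_source_le {b : Rd d → Rd d} {u η : Rd d → ℝ} (hb : Continuous b)
    (hu : ContDiff ℝ 2 u) (n : ℕ) (k : ℝ) (hη : Continuous η) (hc : HasCompactSupport η)
    {A : ℝ} (hA : ∀ x, |driftSource b u x| ≤ A) :
    ∫ x, driftSource b u x * (excess u k x ^ (2 * n + 3) * η x ^ 2) ≤
      A * ∫ x, excess u k x ^ (2 * n + 3) * η x ^ 2 := by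
  have he := continuous_excess hu.continuous k
  have hs := continuous_driftSource hb hu
  rw [← integral_const_mul]
  refine integral_mono
    (integrable_of_eq_zero_of_cutoff (by fun_prop) hc fun x hx => by simp [hx])
    (integrable_of_eq_zero_of_cutoff (by fun_prop) hc fun x hx => by simp [hx]) fun x => ?_
  have := excess_nonneg u k x
  exact mul_le_mul_of_nonneg_right ((le_abs_self _).trans (hA x)) (by positivity)

/-- Energy estimate for a form-bounded drift. The form bound `s ^ 2` enters through `s`, against
the coefficient `2 - 1 / m` of the energy, which is why `m` has to be large when `s` is
close to `2`. -/
theorem energy_le_of_isFormBounded {b : Rd d → Rd d} {u η : Rd d → ℝ} (hb : Continuous b)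
    (hu : ContDiff ℝ 2 u) {n : ℕ} (k : ℝ) (hη : ContDiff ℝ 1 η) (hc : HasCompactSupport η)
    {w : Rd d → ℝ} (hw : w = fun x => excess u k x ^ (n + 2))
    {s c A : ℝ} (hs : 0 < s) (hs2 : s < 2) (hγ : 0 < 2 - 1 / (n + 2 : ℝ) - s)
    (hF : IsFormBounded (s ^ 2) c b) (hA : ∀ x, |driftSource b u x| ≤ A) :
    (2 - 1 / (n + 2 : ℝ) - s) / 2 * (∫ x, η x ^ 2 * ‖gradient w x‖ ^ 2) ≤
      (18 / (2 - 1 / (n + 2 : ℝ) - s) + 2) * (∫ x, w x ^ 2 * ‖gradient η x‖ ^ 2)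
      + c / (2 * s) * (∫ x, (w x * η x) ^ 2) + 0
      + (n + 2) * (A * ∫ x, excess u k x ^ (2 * n + 3) * η x ^ 2) := by
  have hu1 : ContDiff ℝ 1 u := hu.of_le (by norm_num)
  have hwc : ContDiff ℝ 1 w := hw ▸ contDiff_excess_pow hu1 k n
  have hgw := continuous_gradient hwc
  have hηc := hη.continuous
  have hwcc := hwc.continuous
  have hid := energy_identity hb hu n k hη hc hw
  have hsrc := integral_source_le hb hu n k hηc hc hA
  have hφ1 : ContDiff ℝ 1 fun x => w x * η x := hwc.mul hη
  have hφc : HasCompactSupport fun x => w x * η x := hc.mul_left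
  obtain ⟨hint, hform⟩ := hF.bound _ _ (isSobolevWithGradient_of_contDiff hφ1 hφc)
  rw [integral_norm_gradient_mul_sq hwc hη hc] at hform
  have I1 : Integrable fun x => η x ^ 2 * ‖gradient w x‖ ^ 2 :=
    integrable_of_eq_zero_of_cutoff (by fun_prop) hc fun x hx => by simp [hx]
  have hN : 0 ≤ ∫ x, w x ^ 2 * ‖gradient η x‖ ^ 2 := integral_nonneg fun x => by positivity
  have hB : |∫ x, w x * η x ^ 2 * inner ℝ (b x) (gradient w x)| ≤
      s / 2 * (∫ x, η x ^ 2 * ‖gradient w x‖ ^ 2) +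
        1 / (2 * s) * ∫ x, ‖b x‖ ^ 2 * (w x * η x) ^ 2 := by
    rw [← integral_const_mul, ← integral_const_mul,
      ← integral_add (I1.const_mul _) (hint.const_mul _), ← Real.norm_eq_abs]
    refine norm_integral_le_of_norm_le ((I1.const_mul _).add (hint.const_mul _))
      (Filter.Eventually.of_forall fun x => ?_)
    rw [norm_mul, norm_mul, norm_pow, Real.norm_eq_abs, Real.norm_eq_abs, Real.norm_eq_abs]
    have h2 : |w x| * |η x| ^ 2 * |inner ℝ (b x) (gradient w x)| ≤
        (|η x| * ‖gradient w x‖) * (‖b x‖ * |w x * η x|) := by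
      calc _ ≤ |w x| * |η x| ^ 2 * (‖b x‖ * ‖gradient w x‖) := by
            gcongr; exact abs_real_inner_le_norm _ _
        _ = _ := by rw [abs_mul]; ring
    refine h2.trans ?_
    set p := |η x| * ‖gradient w x‖
    set q := ‖b x‖ * |w x * η x|
    have hp : η x ^ 2 * ‖gradient w x‖ ^ 2 = p ^ 2 := by simp [p, mul_pow]
    have hq : ‖b x‖ ^ 2 * (w x * η x) ^ 2 = q ^ 2 := by simp only [q, mul_pow, sq_abs]
    rw [hp, hq]
    have : s / 2 * p ^ 2 + 1 / (2 * s) * q ^ 2 - p * q = (s * p - q) ^ 2 / (2 * s) := by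
      field_simp; ring
    have h3 : 0 ≤ (s * p - q) ^ 2 / (2 * s) := by positivity
    linarith
  refine energy_absorption hγ ?_ (abs_integral_cross_le hwc hη hc (by positivity))
  set E := ∫ x, η x ^ 2 * ‖gradient w x‖ ^ 2
  set T := ∫ x, η x * w x * inner ℝ (gradient w x) (gradient η x)
  set N := ∫ x, w x ^ 2 * ‖gradient η x‖ ^ 2
  set W := ∫ x, (w x * η x) ^ 2
  set B := ∫ x, w x * η x ^ 2 * inner ℝ (b x) (gradient w x)
  set Q := ∫ x, ‖b x‖ ^ 2 * (w x * η x) ^ 2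
  set G := ∫ x, driftSource b u x * (excess u k x ^ (2 * n + 3) * η x ^ 2)
  have hQ : 1 / (2 * s) * Q ≤ s / 2 * (E + 2 * T + N) + c / (2 * s) * W := by
    calc 1 / (2 * s) * Q ≤ 1 / (2 * s) * (s ^ 2 * (E + 2 * T + N) + c * W) := by gcongr
      _ = _ := by field_simp
  have hT1 := le_abs_self T
  have hT2 := neg_abs_le T
  have hB2 := (abs_le.1 hB).1
  have hG : (n + 2 : ℝ) * G ≤ (n + 2) * (A * ∫ x, excess u k x ^ (2 * n + 3) * η x ^ 2) := by
    gcongr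
  have hsT : s * T ≤ 2 * |T| := by nlinarith [abs_nonneg T]
  nlinarith

/-- Energy estimate for a drift whose divergence has a form-bounded positive part. Here the drift
term is integrated by parts, which leaves the term `|b| |∇η| η w²` supported where `η` varies. -/
theorem energy_le_of_divergence {b : Rd d → Rd d} {u η qp qm : Rd d → ℝ} (hb : ContDiff ℝ 1 b)
    (hu : ContDiff ℝ 2 u) {n : ℕ} (k : ℝ) (hη : ContDiff ℝ 1 η) (hc : HasCompactSupport η)
    {w : Rd d → ℝ} (hw : w = fun x => excess u k x ^ (n + 2))
    {δ c A : ℝ} (hδ : 0 < δ) (hδ4 : δ < 4) (hγ : 0 < 2 - 1 / (n + 2 : ℝ) - δ / 2)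
    (hqp : Continuous qp) (hqm : Continuous qm) (hqm0 : ∀ x, 0 ≤ qm x)
    (hdiv : ∀ x, divergence b x = qp x - qm x)
    (hF : IsPotentialFormBounded δ c qp) (hη0 : ∀ x, 0 ≤ η x)
    (hA : ∀ x, |driftSource b u x| ≤ A) :
    (2 - 1 / (n + 2 : ℝ) - δ / 2) / 2 * (∫ x, η x ^ 2 * ‖gradient w x‖ ^ 2) ≤
      (18 / (2 - 1 / (n + 2 : ℝ) - δ / 2) + 2) * (∫ x, w x ^ 2 * ‖gradient η x‖ ^ 2)
      + c / 2 * (∫ x, (w x * η x) ^ 2) + (∫ x, ‖b x‖ * ‖gradient η x‖ * (η x * w x ^ 2))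
      + (n + 2) * (A * ∫ x, excess u k x ^ (2 * n + 3) * η x ^ 2) := by
  have hu1 : ContDiff ℝ 1 u := hu.of_le (by norm_num)
  have hwc : ContDiff ℝ 1 w := hw ▸ contDiff_excess_pow hu1 k n
  have hgw := continuous_gradient hwc
  have hgη := continuous_gradient hη
  have hηc := hη.continuous
  have hwcc := hwc.continuous
  have hbc := hb.continuous
  have hid := energy_identity hbc hu n k hη hc hw
  have hsrc := integral_source_le hbc hu n k hηc hc hA
  have hφ1 : ContDiff ℝ 1 fun x => w x * η x := hwc.mul hη
  have hφc : HasCompactSupport fun x => w x * η x := hc.mul_left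
  obtain ⟨hint, hform⟩ := hF.bound _ _ (isSobolevWithGradient_of_contDiff hφ1 hφc)
  rw [integral_norm_gradient_mul_sq hwc hη hc] at hform
  have hN : 0 ≤ ∫ x, w x ^ 2 * ‖gradient η x‖ ^ 2 := integral_nonneg fun x => by positivity
  have hI : ∀ {f : Rd d → ℝ}, Continuous f → (∀ x, η x = 0 → f x = 0) → Integrable f :=
    fun hf h => integrable_of_eq_zero_of_cutoff hf hc h
  have IX : Integrable fun x => ‖b x‖ * ‖gradient η x‖ * (η x * w x ^ 2) :=
    hI (by fun_prop) fun x hx => by simp [hx]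
  have IY : Integrable fun x => inner ℝ (b x) (gradient η x) * (η x * w x ^ 2) :=
    hI (by fun_prop) fun x hx => by simp [hx]
  have IB : Integrable fun x => w x * η x ^ 2 * inner ℝ (b x) (gradient w x) :=
    hI (by fun_prop) fun x hx => by simp [hx]
  have Iq : Integrable fun x => qp x * (w x * η x) ^ 2 :=
    hI (by fun_prop) fun x hx => by simp [hx]
  have Iqm : Integrable fun x => qm x * (w x * η x) ^ 2 :=
    hI (by fun_prop) fun x hx => by simp [hx]
  -- integrate the drift term by parts against `(w η)²`
  have hparts := integral_inner_gradient_eq hb (hφ1.mul hφ1) (hφc.mul_left (f := fun x => w x * η x))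
  have e1 : ∀ x, inner ℝ (b x) (gradient (fun x => w x * η x * (w x * η x)) x) =
      2 * (w x * η x ^ 2 * inner ℝ (b x) (gradient w x)) +
        2 * (inner ℝ (b x) (gradient η x) * (η x * w x ^ 2)) := fun x => by
    have d1 := hφ1.differentiable (by norm_num) x
    rw [gradient_mul_apply d1 d1, gradient_mul_apply (hwc.differentiable (by norm_num) x)
      (hη.differentiable (by norm_num) x)]
    simp only [inner_add_right, inner_smul_right]
    ring
  have e2 : ∀ x, divergence b x * (w x * η x * (w x * η x)) =
      qp x * (w x * η x) ^ 2 - qm x * (w x * η x) ^ 2 := fun x => by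
    rw [hdiv]; ring
  rw [integral_congr_ae (Filter.Eventually.of_forall e1),
    integral_congr_ae (Filter.Eventually.of_forall e2), integral_sub Iq Iqm,
    integral_add (IB.const_mul 2) (IY.const_mul 2), integral_const_mul, integral_const_mul] at hparts
  have hqm1 : 0 ≤ ∫ x, qm x * (w x * η x) ^ 2 :=
    integral_nonneg fun x => mul_nonneg (hqm0 x) (sq_nonneg _)
  have hY : ∫ x, inner ℝ (b x) (gradient η x) * (η x * w x ^ 2) ≤
      ∫ x, ‖b x‖ * ‖gradient η x‖ * (η x * w x ^ 2) :=
    integral_mono IY IX fun x => mul_le_mul_of_nonneg_right (real_inner_le_norm _ _)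
      (mul_nonneg (hη0 x) (sq_nonneg _))
  refine energy_absorption hγ ?_ (abs_integral_cross_le hwc hη hc (by positivity))
  set E := ∫ x, η x ^ 2 * ‖gradient w x‖ ^ 2
  set T := ∫ x, η x * w x * inner ℝ (gradient w x) (gradient η x)
  set N := ∫ x, w x ^ 2 * ‖gradient η x‖ ^ 2
  set W := ∫ x, (w x * η x) ^ 2
  set B := ∫ x, w x * η x ^ 2 * inner ℝ (b x) (gradient w x)
  set Q := ∫ x, qp x * (w x * η x) ^ 2
  set G := ∫ x, driftSource b u x * (excess u k x ^ (2 * n + 3) * η x ^ 2)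
  have hT1 := le_abs_self T
  have hT2 := neg_abs_le T
  have hG : (n + 2 : ℝ) * G ≤ (n + 2) * (A * ∫ x, excess u k x ^ (2 * n + 3) * η x ^ 2) := by
    gcongr
  have hsT : δ * T ≤ 4 * |T| := by nlinarith [abs_nonneg T]
  nlinarith

end Energy

/-! ### The Caccioppoli inequality -/

section Caccioppoli

variable {d : ℕ}

theorem Continuous.integrableOn_ball' {f : Rd d → ℝ} (hf : Continuous f) (x₀ : Rd d) (r : ℝ) :
    IntegrableOn f (ball x₀ r) :=
  (hf.locallyIntegrable.integrableOn_isCompact (isCompact_closedBall x₀ r)).mono_set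
    ball_subset_closedBall

theorem setIntegral_ball_le_integral {f g : Rd d → ℝ} {x₀ : Rd d} {r : ℝ} (hf : Continuous f)
    (hg : Integrable g) (hg0 : ∀ x, 0 ≤ g x) (h : ∀ x ∈ ball x₀ r, f x ≤ g x) :
    ∫ x in ball x₀ r, f x ≤ ∫ x, g x :=
  (setIntegral_mono_on (hf.integrableOn_ball' x₀ r) hg.integrableOn measurableSet_ball h).trans
    (setIntegral_le_integral hg (Filter.Eventually.of_forall hg0))

theorem integral_le_setIntegral_ball {f g : Rd d → ℝ} {x₀ : Rd d} {r : ℝ} (hf : Continuous f)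
    (hg : Integrable g) (hg0 : ∀ x ∉ ball x₀ r, g x = 0) (h : ∀ x ∈ ball x₀ r, g x ≤ f x) :
    ∫ x, g x ≤ ∫ x in ball x₀ r, f x := by
  rw [← setIntegral_eq_integral_of_forall_compl_eq_zero hg0]
  exact setIntegral_mono_on hg.integrableOn (hf.integrableOn_ball' x₀ r) measurableSet_ball h

/-- Absorption over a family of radii: an estimate of `f s` by half of `f t` at larger radii `t`
upgrades to one without the term in `f`. -/
theorem le_of_le_half_add {f : ℝ → ℝ} {r R X Y F : ℝ} (hrR : r < R) (hX : 0 ≤ X) (hY : 0 ≤ Y)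
    (hF : ∀ s, r ≤ s → s ≤ R → f s ≤ F)
    (h : ∀ s t, r ≤ s → s < t → t ≤ R → f s ≤ 1 / 2 * f t + X / (t - s) ^ 2 + Y) :
    f r ≤ 192 * X / (R - r) ^ 2 + 3 * Y := by
  have hRr : 0 < R - r := by linarith
  set Z := 64 * X + Y * (R - r) ^ 2 with hZ
  have hZ0 : 0 ≤ Z := by positivity
  -- weighting with `(R - s)²` turns the loss of radius into a fixed factor below one
  have step : ∀ s, r ≤ s → s < R → ∃ t, r ≤ t ∧ t < R ∧
      (R - s) ^ 2 * f s ≤ 32 / 49 * ((R - t) ^ 2 * f t) + Z := fun s hs hsR => by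
    have hs' : 0 < R - s := by linarith
    refine ⟨R - 7 / 8 * (R - s), by linarith, by linarith, ?_⟩
    have := h s (R - 7 / 8 * (R - s)) hs (by linarith) (by linarith)
    rw [show R - 7 / 8 * (R - s) - s = (R - s) / 8 by ring] at this
    have h2 := mul_le_mul_of_nonneg_left this (sq_nonneg (R - s))
    have h3 : (R - s) ^ 2 * (X / ((R - s) / 8) ^ 2) = 64 * X := by field_simp; norm_num
    have h4 : (R - s) ^ 2 * Y ≤ Y * (R - r) ^ 2 := by
      rw [mul_comm]; gcongr
    rw [show R - (R - 7 / 8 * (R - s)) = 7 / 8 * (R - s) by ring]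
    nlinarith
  have iter : ∀ N : ℕ, ∀ s, r ≤ s → s < R →
      (R - s) ^ 2 * f s ≤ (32 / 49) ^ N * ((R - r) ^ 2 * max F 0) + 3 * Z := fun N => by
    induction N with
    | zero =>
      intro s hs hsR
      have h1 : (R - s) ^ 2 * f s ≤ (R - r) ^ 2 * max F 0 := by
        calc _ ≤ (R - s) ^ 2 * max F 0 := by
              gcongr; exact (hF s hs hsR.le).trans (le_max_left _ _)
          _ ≤ _ := by gcongr
      simpa using h1.trans (by linarith)
    | succ N ih =>
      intro s hs hsR
      obtain ⟨t, ht, htR, hst⟩ := step s hs hsR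
      have := ih t ht htR
      rw [pow_succ (32 / 49 : ℝ) N]
      nlinarith
  have lim : Filter.Tendsto
      (fun N : ℕ => (32 / 49 : ℝ) ^ N * ((R - r) ^ 2 * max F 0) + 3 * Z) Filter.atTop
      (nhds (0 * ((R - r) ^ 2 * max F 0) + 3 * Z)) :=
    ((tendsto_pow_atTop_nhds_zero_of_lt_one (by norm_num) (by norm_num)).mul_const _).add_const _
  have := ge_of_tendsto' lim fun N => iter N r le_rfl hrR
  rw [zero_mul, zero_add] at this
  rw [show 192 * X / (R - r) ^ 2 + 3 * Y = 3 * Z / (R - r) ^ 2 by rw [hZ]; field_simp; ring,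
    le_div_iff₀ (by positivity)]
  linarith

/-- The Caccioppoli inequality for the powers `(u - k)₊^m`, `m = n + 2`, on concentric balls of
radius at most `2`; `A` is a bound for the source term. -/
def SatisfiesCaccioppoli (n : ℕ) (K A : ℝ) (u : Rd d → ℝ) : Prop :=
  ∀ (x₀ : Rd d) (r R k : ℝ), 0 < r → r < R → R ≤ 2 →
    ∫ x in ball x₀ r, ‖gradient (fun y => excess u k y ^ (n + 2)) x‖ ^ 2 ≤
      K / (R - r) ^ 2 * (∫ x in ball x₀ R, (excess u k x ^ (n + 2)) ^ 2) +
        K * (A * ∫ x in ball x₀ R, excess u k x ^ (2 * n + 3))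

/-- It suffices to prove the Caccioppoli inequality up to half of the energy on the larger ball. -/
theorem satisfiesCaccioppoli_of_half {n : ℕ} {K A : ℝ} {u : Rd d → ℝ} (hK : 0 ≤ K) (hA : 0 ≤ A)
    (hu : ContDiff ℝ 1 u)
    (h : ∀ (x₀ : Rd d) (r R k : ℝ), 0 < r → r < R → R ≤ 2 →
      ∫ x in ball x₀ r, ‖gradient (fun y => excess u k y ^ (n + 2)) x‖ ^ 2 ≤
        1 / 2 * (∫ x in ball x₀ R, ‖gradient (fun y => excess u k y ^ (n + 2)) x‖ ^ 2) +
        K / (R - r) ^ 2 * (∫ x in ball x₀ R, (excess u k x ^ (n + 2)) ^ 2) +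
          K * (A * ∫ x in ball x₀ R, excess u k x ^ (2 * n + 3))) :
    SatisfiesCaccioppoli n (192 * K) A u := by
  intro x₀ r R k hr hrR hR
  have hw := contDiff_excess_pow hu k n
  have hgw := continuous_gradient hw
  have he := continuous_excess hu.continuous k
  have he0 := excess_nonneg u k
  have mono : ∀ {f : Rd d → ℝ}, Continuous f → (∀ x, 0 ≤ f x) → ∀ {s t : ℝ}, s ≤ t →
      ∫ x in ball x₀ s, f x ≤ ∫ x in ball x₀ t, f x := fun hf h0 _ _ hst =>
    setIntegral_mono_set (hf.integrableOn_ball' _ _)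
      (Filter.Eventually.of_forall h0) (ball_subset_ball hst).eventuallyLE
  have hV : 0 ≤ ∫ x in ball x₀ R, excess u k x ^ (2 * n + 3) :=
    setIntegral_nonneg measurableSet_ball fun x _ => pow_nonneg (he0 x) _
  have hW : 0 ≤ ∫ x in ball x₀ R, (excess u k x ^ (n + 2)) ^ 2 :=
    setIntegral_nonneg measurableSet_ball fun x _ => by positivity
  have := le_of_le_half_add
    (f := fun s => ∫ x in ball x₀ s, ‖gradient (fun y => excess u k y ^ (n + 2)) x‖ ^ 2)
    (X := K * ∫ x in ball x₀ R, (excess u k x ^ (n + 2)) ^ 2)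
    (Y := K * (A * ∫ x in ball x₀ R, excess u k x ^ (2 * n + 3)))
    (F := ∫ x in ball x₀ R, ‖gradient (fun y => excess u k y ^ (n + 2)) x‖ ^ 2)
    hrR (by positivity) (by positivity)
    (fun s _ hs => mono (by fun_prop) (fun x => by positivity) hs)
    (fun s t hs hst ht => by
      refine (h x₀ s t k (by linarith) hst (by linarith)).trans ?_
      have h1 := mono (f := fun x => (excess u k x ^ (n + 2)) ^ 2) (by fun_prop)
        (fun x => by positivity) ht
      have h2 := mono (f := fun x => excess u k x ^ (2 * n + 3)) (by fun_prop)
        (fun x => pow_nonneg (he0 x) _) ht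
      rw [mul_div_right_comm K]
      gcongr)
  refine this.trans ?_
  have e : 192 * (K * ∫ x in ball x₀ R, (excess u k x ^ (n + 2)) ^ 2) / (R - r) ^ 2 =
      192 * K / (R - r) ^ 2 * ∫ x in ball x₀ R, (excess u k x ^ (n + 2)) ^ 2 := by ring
  rw [e]
  have : 0 ≤ K * (A * ∫ x in ball x₀ R, excess u k x ^ (2 * n + 3)) := by positivity
  linarith

section CutoffBounds

variable {w η : Rd d → ℝ} {L r R : ℝ} {x₀ : Rd d}

theorem IsCutoff.integral_sq_mul_gradient_le (hη : IsCutoff L x₀ r R η) (hw : Continuous w) :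
    ∫ x, w x ^ 2 * ‖gradient η x‖ ^ 2 ≤ (L / (R - r)) ^ 2 * ∫ x in ball x₀ R, w x ^ 2 := by
  rw [← integral_const_mul]
  have hgη := continuous_gradient hη.contDiff
  refine integral_le_setIntegral_ball (by fun_prop) ?_ (fun x hx => by simp [hη.grad_eq_zero x hx])
    fun x _ => ?_
  · exact Continuous.integrable_of_hasCompactSupport (by fun_prop)
      (hη.hasCompactSupport.gradient.mono fun x hx h0 => hx (by simp [h0]))
  · rw [mul_comm]
    gcongr
    exact hη.grad_le x

theorem IsCutoff.integral_mul_pow_le (hη : IsCutoff L x₀ r R η) {f : Rd d → ℝ} (hf : Continuous f)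
    (hf0 : ∀ x, 0 ≤ f x) : ∫ x, f x * η x ^ 2 ≤ ∫ x in ball x₀ R, f x := by
  have hηc := hη.contDiff.continuous
  refine integral_le_setIntegral_ball hf ?_ (fun x hx => by simp [hη.eq_zero x hx]) fun x _ => ?_
  · exact integrable_of_eq_zero_of_cutoff (by fun_prop) hη.hasCompactSupport
      fun x hx => by simp [hx]
  · exact mul_le_of_le_one_right (hf0 x) (pow_le_one₀ (hη.nonneg x) (hη.le_one x))

theorem IsCutoff.setIntegral_le_integral_mul (hη : IsCutoff L x₀ r R η) {f : Rd d → ℝ}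
    (hf : Continuous f) (hf0 : ∀ x, 0 ≤ f x) :
    ∫ x in ball x₀ r, f x ≤ ∫ x, η x ^ 2 * f x := by
  have hηc := hη.contDiff.continuous
  refine setIntegral_ball_le_integral hf ?_ (fun x => mul_nonneg (sq_nonneg _) (hf0 x))
    fun x hx => by simp [hη.eq_one x hx]
  exact integrable_of_eq_zero_of_cutoff (by fun_prop) hη.hasCompactSupport fun x hx => by simp [hx]

theorem IsCutoff.integral_gradient_mul_sq_le (hη : IsCutoff L x₀ r R η) (hw : ContDiff ℝ 1 w) :
    ∫ x, ‖gradient (fun y => w y * η y) x‖ ^ 2 ≤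
      2 * (∫ x in ball x₀ R, ‖gradient w x‖ ^ 2) +
        2 * ((L / (R - r)) ^ 2 * ∫ x in ball x₀ R, w x ^ 2) := by
  have hwc := hw.continuous
  have hgw := continuous_gradient hw
  have hηc := hη.contDiff.continuous
  have hgη := continuous_gradient hη.contDiff
  have hgφ := continuous_gradient (hw.mul hη.contDiff)
  have hφc : HasCompactSupport fun x => w x * η x := hη.hasCompactSupport.mul_left
  have I1 : Integrable fun x => ‖gradient w x‖ ^ 2 * η x ^ 2 :=
    integrable_of_eq_zero_of_cutoff (by fun_prop) hη.hasCompactSupport fun x hx => by simp [hx]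
  have I3 : Integrable fun x => w x ^ 2 * ‖gradient η x‖ ^ 2 :=
    Continuous.integrable_of_hasCompactSupport (by fun_prop)
      (hη.hasCompactSupport.gradient.mono fun x hx h0 => hx (by simp [h0]))
  have h1 := hη.integral_mul_pow_le (f := fun x => ‖gradient w x‖ ^ 2) (by fun_prop)
    fun x => by positivity
  have h2 := hη.integral_sq_mul_gradient_le hwc
  have h3 : ∫ x, ‖gradient (fun y => w y * η y) x‖ ^ 2 ≤
      ∫ x, (2 * (‖gradient w x‖ ^ 2 * η x ^ 2) + 2 * (w x ^ 2 * ‖gradient η x‖ ^ 2)) := by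
    refine integral_mono ?_ ((I1.const_mul 2).add (I3.const_mul 2)) fun x => ?_
    · exact Continuous.integrable_of_hasCompactSupport (by fun_prop)
        (hφc.gradient.mono fun x hx h0 => hx (by simp [h0]))
    · simp only [gradient_mul_apply (hw.differentiable (by norm_num) x)
        (hη.contDiff.differentiable (by norm_num) x)]
      have h4 := norm_add_le (w x • gradient η x) (η x • gradient w x)
      rw [norm_smul, norm_smul, Real.norm_eq_abs, Real.norm_eq_abs] at h4
      have h5 : ‖w x • gradient η x + η x • gradient w x‖ ^ 2 ≤
          (|w x| * ‖gradient η x‖ + |η x| * ‖gradient w x‖) ^ 2 := by gcongr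
      have h6 : w x ^ 2 * ‖gradient η x‖ ^ 2 = (|w x| * ‖gradient η x‖) ^ 2 := by
        rw [mul_pow, sq_abs]
      have h7 : ‖gradient w x‖ ^ 2 * η x ^ 2 = (|η x| * ‖gradient w x‖) ^ 2 := by
        rw [mul_pow, sq_abs]; ring
      rw [h6, h7]
      nlinarith [sq_nonneg (|w x| * ‖gradient η x‖ - |η x| * ‖gradient w x‖)]
  rw [integral_add (I1.const_mul 2) (I3.const_mul 2), integral_const_mul,
    integral_const_mul] at h3
  linarith

end CutoffBounds

/-- The choice of the exponent `m = n + 2`. -/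
theorem exists_exponent {s : ℝ} (hs : s < 2) : ∃ n : ℕ, 0 < 2 - 1 / (n + 2 : ℝ) - s := by
  obtain ⟨n, hn⟩ := exists_nat_gt (1 / (2 - s))
  refine ⟨n, ?_⟩
  have h2 : 0 < 2 - s := by linarith
  have : 1 / (n + 2 : ℝ) < 2 - s := by
    rw [div_lt_iff₀ (by positivity)]
    rw [div_lt_iff₀ h2] at hn
    nlinarith
  linarith

/-- For a form-bounded drift with form bound `δ < 4`, the Caccioppoli inequality holds with constants
that depend on the drift only through `δ` and `c`. -/
theorem caccioppoli_of_isFormBounded (d : ℕ) {δ c : ℝ} (hδ : δ < 4) : ∃ (n : ℕ) (K : ℝ), 0 ≤ K ∧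
    ∀ (b : Rd d → Rd d) (u : Rd d → ℝ) (A : ℝ), Continuous b → IsFormBounded δ c b →
      ContDiff ℝ 2 u → (∀ x, |driftSource b u x| ≤ A) → SatisfiesCaccioppoli n K A u := by
  -- enlarge `δ` to a positive square `s ^ 2 < 4`
  set s := √(max δ 1) with hs_def
  have hm : 0 < max δ 1 := by positivity
  have hs : 0 < s := Real.sqrt_pos.2 hm
  have hs2 : s < 2 := by
    rw [hs_def, Real.sqrt_lt' (by norm_num)]
    exact max_lt (by linarith) (by norm_num)
  have hss : s ^ 2 = max δ 1 := Real.sq_sqrt hm.le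
  obtain ⟨n, hn⟩ := exists_exponent hs2
  obtain ⟨L, hL1, hL⟩ := exists_cutoff d
  set γ := 2 - 1 / (n + 2 : ℝ) - s with hγ
  set K := 2 / γ * ((18 / γ + 2) * L ^ 2 + |c| / (2 * s) * 4 + (n + 2)) with hK
  have hK0 : 0 ≤ K := by positivity
  refine ⟨n, 192 * K, by positivity, fun b u A hb hF hu hA => ?_⟩
  have hA0 : 0 ≤ A := (abs_nonneg _).trans (hA 0)
  have hu1 : ContDiff ℝ 1 u := hu.of_le (by norm_num)
  have hF' : IsFormBounded (s ^ 2) c b := ⟨hF.measurable, hF.locallySqIntegrable, fun φ G hφ => by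
    obtain ⟨h1, h2⟩ := hF.bound φ G hφ
    refine ⟨h1, h2.trans ?_⟩
    have : 0 ≤ ∫ x, ‖G x‖ ^ 2 := integral_nonneg fun x => by positivity
    have : δ * (∫ x, ‖G x‖ ^ 2) ≤ s ^ 2 * ∫ x, ‖G x‖ ^ 2 := by
      gcongr; rw [hss]; exact le_max_left _ _
    linarith⟩
  refine satisfiesCaccioppoli_of_half hK0 hA0 hu1 fun x₀ r R k hr hrR hR => ?_
  obtain ⟨η, hη⟩ := hL x₀ r R hr hrR
  set w : Rd d → ℝ := fun y => excess u k y ^ (n + 2) with hw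
  have hwc : ContDiff ℝ 1 w := contDiff_excess_pow hu1 k n
  have hgw := continuous_gradient hwc
  have hec := continuous_excess hu1.continuous k
  have hen := energy_le_of_isFormBounded hb hu k hη.contDiff hη.hasCompactSupport hw hs hs2 hn hF' hA
  have h1 := hη.setIntegral_le_integral_mul (f := fun x => ‖gradient w x‖ ^ 2) (by fun_prop)
    fun x => by positivity
  have h2 := hη.integral_sq_mul_gradient_le hwc.continuous
  have h3 := hη.integral_mul_pow_le (f := fun x => w x ^ 2) (by have := hwc.continuous; fun_prop)
    fun x => by positivity
  have h4 := hη.integral_mul_pow_le (f := fun x => excess u k x ^ (2 * n + 3)) (by fun_prop)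
    fun x => pow_nonneg (excess_nonneg u k x) _
  have h5 : 0 ≤ ∫ x in ball x₀ R, ‖gradient w x‖ ^ 2 :=
    setIntegral_nonneg measurableSet_ball fun x _ => by positivity
  simp only [← mul_pow] at h3
  set E := ∫ x, η x ^ 2 * ‖gradient w x‖ ^ 2
  set N := ∫ x, w x ^ 2 * ‖gradient η x‖ ^ 2
  set W := ∫ x, (w x * η x) ^ 2
  set V := ∫ x, excess u k x ^ (2 * n + 3) * η x ^ 2
  set W' := ∫ x in ball x₀ R, w x ^ 2
  set V' := ∫ x in ball x₀ R, excess u k x ^ (2 * n + 3)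
  have hW0 : 0 ≤ W := integral_nonneg fun x => by positivity
  have hW' : 0 ≤ W' := setIntegral_nonneg measurableSet_ball fun x _ => by positivity
  have hV' : 0 ≤ V' := setIntegral_nonneg measurableSet_ball
    fun x _ => pow_nonneg (excess_nonneg u k x) _
  have hi : 1 ≤ 4 * (1 / (R - r) ^ 2) := by
    rw [mul_one_div, le_div_iff₀ (by nlinarith)]; nlinarith
  have hcW : c / (2 * s) * W ≤ |c| / (2 * s) * (4 * (1 / (R - r) ^ 2) * W') := by
    have : W ≤ 4 * (1 / (R - r) ^ 2) * W' := by nlinarith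
    gcongr
    exact le_abs_self c
  have hcN : (18 / γ + 2) * N ≤ (18 / γ + 2) * ((L / (R - r)) ^ 2 * W') := by gcongr
  have hcV : (n + 2 : ℝ) * (A * V) ≤ (n + 2) * (A * V') := by gcongr
  have hE : E ≤ 2 / γ * ((18 / γ + 2) * ((L / (R - r)) ^ 2 * W')
      + |c| / (2 * s) * (4 * (1 / (R - r) ^ 2) * W') + (n + 2) * (A * V')) := by
    rw [div_mul_eq_mul_div, le_div_iff₀ hn]
    linarith
  have e1 : (L / (R - r)) ^ 2 = L ^ 2 * (1 / (R - r) ^ 2) := by rw [div_pow]; ring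
  have e2 : K / (R - r) ^ 2 = K * (1 / (R - r) ^ 2) := by ring
  rw [e1] at hE
  rw [e2]
  set i := 1 / (R - r) ^ 2
  have p1 : 0 ≤ i := by positivity
  have q1 : 0 ≤ 2 / γ * (n + 2) * (i * W') := by positivity
  have q2 : 0 ≤ 2 / γ * ((18 / γ + 2) * L ^ 2 + |c| / (2 * s) * 4) * (A * V') := by positivity
  have : K * i * W' + K * (A * V') = 2 / γ * ((18 / γ + 2) * (L ^ 2 * i * W')
      + |c| / (2 * s) * (4 * i * W') + (n + 2) * (A * V')) + 2 / γ * (n + 2) * (i * W') +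
      2 / γ * ((18 / γ + 2) * L ^ 2 + |c| / (2 * s) * 4) * (A * V') := by rw [hK]; ring
  linarith

/-- Under the multiplicative form bound, `∫ |b| |∇η| η w²` is controlled by a fraction of the energy
on a larger ball; `ζ` is a second cutoff function, equal to one where `η` lives. -/
theorem integral_drift_cutoff_le {b : Rd d → Rd d} {w η ζ : Rd d → ℝ} {κ c L r R : ℝ} {x₀ : Rd d}
    (hb : Continuous b) (hF : IsMulFormBounded κ c b) (hw : ContDiff ℝ 1 w) (hr : r < R)
    (hR : R - r ≤ 2) (hL : 0 ≤ L) (hη : IsCutoff L x₀ r ((r + R) / 2) η) (hζ : IsCutoff L x₀ ((r + R) / 2) R ζ)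
    {K : ℝ} (hK : 0 ≤ K) :
    K * ∫ x, ‖b x‖ * ‖gradient η x‖ * (η x * w x ^ 2) ≤
      1 / 2 * (∫ x in ball x₀ R, ‖gradient w x‖ ^ 2) +
      (2 * L ^ 2 + (K * (2 * L) * κ) ^ 2 + 4 * K * L * |c|) * (1 / (R - r) ^ 2) *
        ∫ x in ball x₀ R, w x ^ 2 := by
  have hh : 0 < R - r := by linarith
  have hwc := hw.continuous
  have hgw := continuous_gradient hw
  have hηc := hη.contDiff.continuous
  have hgη := continuous_gradient hη.contDiff
  have hζc := hζ.contDiff.continuous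
  have hgζ := continuous_gradient hζ.contDiff
  have hφ1 : ContDiff ℝ 1 fun x => w x * ζ x := hw.mul hζ.contDiff
  have hφc : HasCompactSupport fun x => w x * ζ x := hζ.hasCompactSupport.mul_left
  have hgφ := continuous_gradient hφ1
  obtain ⟨hint, hform⟩ := hF.bound _ _ (isSobolevWithGradient_of_contDiff hφ1 hφc)
  have e1 : L / ((r + R) / 2 - r) = 2 * L / (R - r) := by
    rw [show (r + R) / 2 - r = (R - r) / 2 by ring]; field_simp
  have e2 : L / (R - (r + R) / 2) = 2 * L / (R - r) := by
    rw [show R - (r + R) / 2 = (R - r) / 2 by ring]; field_simp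
  have hX : ∫ x, ‖b x‖ * ‖gradient η x‖ * (η x * w x ^ 2) ≤
      2 * L / (R - r) * ∫ x, ‖b x‖ * (w x * ζ x) ^ 2 := by
    rw [← integral_const_mul]
    refine integral_mono (integrable_of_eq_zero_of_cutoff (by fun_prop) hη.hasCompactSupport
      fun x hx => by simp [hx]) (hint.const_mul _) fun x => ?_
    by_cases hx : x ∈ ball x₀ ((r + R) / 2)
    · have h1 := hη.grad_le x
      rw [e1] at h1
      have h2 := hη.nonneg x
      have h3 := hη.le_one x
      simp only [hζ.eq_one x hx, mul_one]
      calc ‖b x‖ * ‖gradient η x‖ * (η x * w x ^ 2)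
          ≤ ‖b x‖ * (2 * L / (R - r)) * (1 * w x ^ 2) := by gcongr
        _ = _ := by ring
    · simp only [hη.eq_zero x hx, zero_mul, mul_zero]
      positivity
  have hV : ∫ x, (w x * ζ x) ^ 2 ≤ ∫ x in ball x₀ R, w x ^ 2 := by
    simp only [mul_pow]
    exact hζ.integral_mul_pow_le (by fun_prop) fun x => by positivity
  have hD : ∫ x, ‖gradient (fun y => w y * ζ y) x‖ ^ 2 ≤
      2 * (∫ x in ball x₀ R, ‖gradient w x‖ ^ 2) +
        2 * ((2 * L / (R - r)) ^ 2 * ∫ x in ball x₀ R, w x ^ 2) := by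
    have h := hζ.integral_gradient_mul_sq_le hw
    rwa [e2] at h
  have hV0 : 0 ≤ ∫ x, (w x * ζ x) ^ 2 := integral_nonneg fun x => by positivity
  have hD0 : 0 ≤ ∫ x, ‖gradient (fun y => w y * ζ y) x‖ ^ 2 := integral_nonneg fun x => by positivity
  set X := ∫ x, ‖b x‖ * ‖gradient η x‖ * (η x * w x ^ 2)
  set Q := ∫ x, ‖b x‖ * (w x * ζ x) ^ 2
  set V := ∫ x, (w x * ζ x) ^ 2
  set D := ∫ x, ‖gradient (fun y => w y * ζ y) x‖ ^ 2
  set E' := ∫ x in ball x₀ R, ‖gradient w x‖ ^ 2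
  set W' := ∫ x in ball x₀ R, w x ^ 2
  have hi2 : 1 / (R - r) ≤ 2 * (1 / (R - r) ^ 2) := by
    rw [mul_one_div, div_le_div_iff₀ hh (by positivity)]; nlinarith
  have e3 : 1 / (R - r) ^ 2 = (1 / (R - r)) ^ 2 := by rw [div_pow, one_pow]
  rw [show 2 * L / (R - r) = 2 * L * (1 / (R - r)) by ring] at hX hD
  rw [e3] at hi2 ⊢
  set i := 1 / (R - r)
  have hi : 0 ≤ i := by positivity
  have hVs : √V ^ 2 = V := Real.sq_sqrt hV0
  have hDs : √D ^ 2 = D := Real.sq_sqrt hD0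
  have hQ : K * X ≤ K * (2 * L * i * (κ * (√D * √V) + |c| * V)) := by
    gcongr
    refine hX.trans ?_
    gcongr
    refine hform.trans ?_
    gcongr
    exact le_abs_self c
  have y1 : K * (2 * L * i * (κ * (√D * √V))) ≤
      1 / 4 * √D ^ 2 + (K * (2 * L) * κ) ^ 2 * i ^ 2 * √V ^ 2 := by
    nlinarith [sq_nonneg (1 / 2 * √D - K * (2 * L) * κ * i * √V)]
  rw [hVs, hDs] at y1
  have y2 : K * (2 * L * i * (|c| * V)) ≤ 4 * K * L * |c| * i ^ 2 * V := by
    have := mul_le_mul_of_nonneg_left hi2 (show 0 ≤ K * (2 * L) * |c| * V by positivity)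
    nlinarith
  have y3 : ((K * (2 * L) * κ) ^ 2 * i ^ 2 + 4 * K * L * |c| * i ^ 2) * V ≤
      ((K * (2 * L) * κ) ^ 2 * i ^ 2 + 4 * K * L * |c| * i ^ 2) * W' := by gcongr
  nlinarith

set_option maxHeartbeats 1000000 in
/-- For a multiplicatively form-bounded drift whose divergence has a positive part with form bound
`δ < 4`, the Caccioppoli inequality holds with constants that depend on the drift only through the
form bounds. -/
theorem caccioppoli_of_divergence (d : ℕ) {κ c δ cp : ℝ} (hδ : δ < 4) :
    ∃ (n : ℕ) (K : ℝ), 0 ≤ K ∧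
    ∀ (b : Rd d → Rd d) (u : Rd d → ℝ) (A : ℝ), ContDiff ℝ 1 b → IsMulFormBounded κ c b →
      HasFormBoundedDivPlus δ cp b → ContDiff ℝ 2 u → (∀ x, |driftSource b u x| ≤ A) →
      SatisfiesCaccioppoli n K A u := by
  -- enlarge `δ` to a positive number below `4`
  set δ' := max δ 1 with hδ'
  have hδ0 : 0 < δ' := by positivity
  have hδ4 : δ' < 4 := max_lt hδ (by norm_num)
  obtain ⟨n, hn⟩ := exists_exponent (s := δ' / 2) (by linarith)
  obtain ⟨L, hL1, hL⟩ := exists_cutoff d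
  set γ := 2 - 1 / (n + 2 : ℝ) - δ' / 2 with hγ
  set J := 2 * L ^ 2 + (2 / γ * (2 * L) * κ) ^ 2 + 4 * (2 / γ) * L * |c| with hJ
  have hL0 : 0 ≤ L := by linarith
  have hJ0 : 0 ≤ J := by positivity
  set K := 2 / γ * ((18 / γ + 2) * (4 * L ^ 2) + |cp| / 2 * 4 + (n + 2)) + J with hK
  have hK0 : 0 ≤ K := by positivity
  refine ⟨n, 192 * K, by positivity, fun b u A hb hF hdivp hu hA => ?_⟩
  obtain ⟨qp, qm, hqp, hqm, hqp0, hqm0, hdiv, hpot⟩ := hdivp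
  have hA0 : 0 ≤ A := (abs_nonneg _).trans (hA 0)
  have hu1 : ContDiff ℝ 1 u := hu.of_le (by norm_num)
  have hpot' : IsPotentialFormBounded δ' cp qp := ⟨hpot.locallyIntegrable, fun φ G hφ => by
    obtain ⟨h1, h2⟩ := hpot.bound φ G hφ
    refine ⟨h1, h2.trans ?_⟩
    have : 0 ≤ ∫ x, ‖G x‖ ^ 2 := integral_nonneg fun x => by positivity
    have : δ * (∫ x, ‖G x‖ ^ 2) ≤ δ' * ∫ x, ‖G x‖ ^ 2 := by
      gcongr; exact le_max_left _ _
    linarith⟩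
  refine satisfiesCaccioppoli_of_half hK0 hA0 hu1 fun x₀ r R k hr hrR hR => ?_
  obtain ⟨η, hη⟩ := hL x₀ r ((r + R) / 2) hr (by linarith)
  obtain ⟨ζ, hζ⟩ := hL x₀ ((r + R) / 2) R (by linarith) (by linarith)
  set w : Rd d → ℝ := fun y => excess u k y ^ (n + 2) with hw
  have hwc : ContDiff ℝ 1 w := contDiff_excess_pow hu1 k n
  have hwcc := hwc.continuous
  have hgw := continuous_gradient hwc
  have hec := continuous_excess hu1.continuous k
  have hen := energy_le_of_divergence hb hu k hη.contDiff hη.hasCompactSupport hw hδ0 hδ4 hn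
    hqp.1.continuous hqm.1.continuous hqm0 hdiv hpot' hη.nonneg hA
  have hX := integral_drift_cutoff_le hb.continuous hF hwc hrR (by linarith) hL0 hη hζ
    (K := 2 / γ) (by positivity)
  rw [← hγ] at hen
  rw [← hJ] at hX
  have mono : ∀ {f : Rd d → ℝ}, Continuous f → (∀ x, 0 ≤ f x) →
      ∫ x in ball x₀ ((r + R) / 2), f x ≤ ∫ x in ball x₀ R, f x := fun hf h0 =>
    setIntegral_mono_set (hf.integrableOn_ball' _ _)
      (Filter.Eventually.of_forall h0) (ball_subset_ball (by linarith)).eventuallyLE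
  have h1 := hη.setIntegral_le_integral_mul (f := fun x => ‖gradient w x‖ ^ 2) (by fun_prop)
    fun x => by positivity
  have h2 := hη.integral_sq_mul_gradient_le hwcc
  have h3 := (hη.integral_mul_pow_le (f := fun x => w x ^ 2) (by fun_prop)
    fun x => by positivity).trans (mono (by fun_prop) fun x => by positivity)
  have h4 := (hη.integral_mul_pow_le (f := fun x => excess u k x ^ (2 * n + 3)) (by fun_prop)
    fun x => pow_nonneg (excess_nonneg u k x) _).trans
    (mono (by fun_prop) fun x => pow_nonneg (excess_nonneg u k x) _)
  have h2' := mono (f := fun x => w x ^ 2) (by fun_prop) fun x => by positivity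
  simp only [← mul_pow] at h3
  set E := ∫ x, η x ^ 2 * ‖gradient w x‖ ^ 2
  set N := ∫ x, w x ^ 2 * ‖gradient η x‖ ^ 2
  set W := ∫ x, (w x * η x) ^ 2
  set V := ∫ x, excess u k x ^ (2 * n + 3) * η x ^ 2
  set X := ∫ x, ‖b x‖ * ‖gradient η x‖ * (η x * w x ^ 2)
  set W' := ∫ x in ball x₀ R, w x ^ 2
  set V' := ∫ x in ball x₀ R, excess u k x ^ (2 * n + 3)
  set E' := ∫ x in ball x₀ R, ‖gradient w x‖ ^ 2
  have hW0 : 0 ≤ W := integral_nonneg fun x => by positivity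
  have hW' : 0 ≤ W' := setIntegral_nonneg measurableSet_ball fun x _ => by positivity
  have hV' : 0 ≤ V' := setIntegral_nonneg measurableSet_ball
    fun x _ => pow_nonneg (excess_nonneg u k x) _
  have hi : 1 ≤ 4 * (1 / (R - r) ^ 2) := by
    rw [mul_one_div, le_div_iff₀ (by nlinarith)]; nlinarith
  have hcW : cp / 2 * W ≤ |cp| / 2 * (4 * (1 / (R - r) ^ 2) * W') := by
    have : W ≤ 4 * (1 / (R - r) ^ 2) * W' := by nlinarith
    gcongr
    exact le_abs_self cp
  have e1 : (L / ((r + R) / 2 - r)) ^ 2 = 4 * L ^ 2 * (1 / (R - r) ^ 2) := by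
    rw [show (r + R) / 2 - r = (R - r) / 2 by ring, div_pow, div_pow]
    field_simp
    norm_num
  rw [e1] at h2
  have hcN : (18 / γ + 2) * N ≤ (18 / γ + 2) * (4 * L ^ 2 * (1 / (R - r) ^ 2) * W') := by
    gcongr
    exact h2.trans (by gcongr)
  have hcV : (n + 2 : ℝ) * (A * V) ≤ (n + 2) * (A * V') := by gcongr
  have hE : E ≤ 2 / γ * ((18 / γ + 2) * (4 * L ^ 2 * (1 / (R - r) ^ 2) * W')
      + |cp| / 2 * (4 * (1 / (R - r) ^ 2) * W') + X + (n + 2) * (A * V')) := by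
    rw [div_mul_eq_mul_div, le_div_iff₀ hn]
    linarith
  have e2 : K / (R - r) ^ 2 = K * (1 / (R - r) ^ 2) := by ring
  rw [e2]
  set i := 1 / (R - r) ^ 2
  have p1 : 0 ≤ i := by positivity
  have q1 : 0 ≤ 2 / γ * (n + 2) * (i * W') := by positivity
  have q2 : 0 ≤ (2 / γ * ((18 / γ + 2) * (4 * L ^ 2) + |cp| / 2 * 4) + J) * (A * V') := by
    positivity
  have : K * i * W' + K * (A * V') = 2 / γ * ((18 / γ + 2) * (4 * L ^ 2 * i * W')
      + |cp| / 2 * (4 * i * W') + X + (n + 2) * (A * V')) - 2 / γ * X + J * i * W'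
      + 2 / γ * (n + 2) * (i * W') +
      (2 / γ * ((18 / γ + 2) * (4 * L ^ 2) + |cp| / 2 * 4) + J) * (A * V') := by rw [hK]; ring
  linarith

/-- The lower-order term of the Caccioppoli inequality is absorbed by passing to a lower level. -/
theorem SatisfiesCaccioppoli.level {n : ℕ} {K A : ℝ} {u : Rd d → ℝ}
    (h : SatisfiesCaccioppoli n K A u) (hK : 0 ≤ K) (hA : 0 ≤ A) (hu : Continuous u)
    {x₀ : Rd d} {r R k h' : ℝ} (hr : 0 < r) (hrR : r < R) (hR : R ≤ 2) (hk : h' < k) :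
    ∫ x in ball x₀ r, ‖gradient (fun y => excess u k y ^ (n + 2)) x‖ ^ 2 ≤
      K * (1 / (R - r) ^ 2 + A / (k - h')) *
        ∫ x in ball x₀ R, (excess u h' x ^ (n + 2)) ^ 2 := by
  have hkh : 0 < k - h' := by linarith
  have hc1 := continuous_excess hu k
  have hc2 := continuous_excess hu h'
  have hle : ∀ x, excess u k x ≤ excess u h' x := fun x => max_le_max (by linarith) le_rfl
  have i1 : ∫ x in ball x₀ R, (excess u k x ^ (n + 2)) ^ 2 ≤
      ∫ x in ball x₀ R, (excess u h' x ^ (n + 2)) ^ 2 := by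
    refine setIntegral_mono_on (Continuous.integrableOn_ball' (by fun_prop) _ _)
      (Continuous.integrableOn_ball' (by fun_prop) _ _) measurableSet_ball fun x _ => ?_
    have := excess_nonneg u k x
    have := hle x
    gcongr
  have i2 : ∫ x in ball x₀ R, excess u k x ^ (2 * n + 3) ≤
      1 / (k - h') * ∫ x in ball x₀ R, (excess u h' x ^ (n + 2)) ^ 2 := by
    rw [← integral_const_mul]
    refine setIntegral_mono_on (Continuous.integrableOn_ball' (by fun_prop) _ _)
      (Continuous.integrableOn_ball' (by fun_prop) _ _) measurableSet_ball fun x _ => ?_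
    have h0 := excess_nonneg u k x
    have h1 := hle x
    rw [one_div_mul_eq_div, le_div_iff₀ hkh, ← pow_mul]
    rcases le_or_gt (u x) k with hx | hx
    · have : excess u k x = 0 := max_eq_right (by linarith)
      rw [this, zero_pow (by omega), zero_mul]
      exact pow_nonneg (excess_nonneg u h' x) _
    · have h2 : k - h' ≤ excess u h' x := le_trans (by linarith) (le_max_left _ _)
      have h3 := excess_nonneg u h' x
      calc excess u k x ^ (2 * n + 3) * (k - h') ≤
          excess u h' x ^ (2 * n + 3) * excess u h' x := by gcongr
        _ = _ := by ring
  refine (h x₀ r R k hr hrR hR).trans ?_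
  calc _ ≤ K / (R - r) ^ 2 * (∫ x in ball x₀ R, (excess u h' x ^ (n + 2)) ^ 2) +
        K * (A * (1 / (k - h') * ∫ x in ball x₀ R, (excess u h' x ^ (n + 2)) ^ 2)) := by
        gcongr
    _ = _ := by ring

end Caccioppoli

/-! ### Small superlevel sets -/

section SmallLevelSets

variable {d : ℕ}

open scoped ENNReal in
/-- The `L¹` Sobolev inequality combined with Hölder's inequality on the support. The measure of the
support is compared with `s ^ d` so that no fractional power appears. -/
theorem exists_integral_abs_le_of_support (hd : 2 ≤ d) : ∃ C : ℝ, 0 ≤ C ∧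
    ∀ (F : Rd d → ℝ) (s : ℝ), ContDiff ℝ 1 F → HasCompactSupport F → 0 ≤ s →
      volume (Function.support F) ≤ ENNReal.ofReal (s ^ d) →
      ∫ x, |F x| ≤ C * s * ∫ x, ‖gradient F x‖ := by
  set p : ℝ≥0 := NNReal.conjExponent d with hp_def
  have hp : NNReal.HolderConjugate (Module.finrank ℝ (Rd d)) p := by
    rw [finrank_euclideanSpace_fin]
    exact NNReal.HolderConjugate.conjExponent (by exact_mod_cast hd)
  set C := eLpNormLESNormFDerivOneConst (volume : Measure (Rd d)) p
  refine ⟨C, C.coe_nonneg, fun F s hF hc hs hvol => ?_⟩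
  have h1 : eLpNorm F p volume ≤ C * eLpNorm (fderiv ℝ F) 1 volume :=
    eLpNorm_le_eLpNorm_fderiv_one (volume : Measure (Rd d)) hF hc hp
  have hp1 : (1 : ℝ≥0∞) ≤ p := by exact_mod_cast hp.symm.lt.le
  have h2 : eLpNorm F 1 volume ≤ eLpNorm F p volume * ENNReal.ofReal s := by
    rw [← eLpNorm_restrict_eq_of_support_subset (s := Function.support F) subset_rfl]
    refine (eLpNorm_le_eLpNorm_mul_rpow_measure_univ hp1
      hF.continuous.aestronglyMeasurable).trans ?_
    rw [eLpNorm_restrict_eq_of_support_subset subset_rfl]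
    gcongr
    rw [Measure.restrict_apply_univ]
    have he : 1 / (1 : ℝ≥0∞).toReal - 1 / (p : ℝ≥0∞).toReal = (d : ℝ)⁻¹ := by
      have := hp.coe.inv_add_inv_eq_one
      rw [finrank_euclideanSpace_fin] at this
      simp only [ENNReal.toReal_one, ENNReal.coe_toReal, one_div, inv_one]
      have e : (((d : ℝ≥0) : ℝ))⁻¹ = (d : ℝ)⁻¹ := by simp
      rw [← e]; linarith
    rw [he]
    calc volume (Function.support F) ^ (d : ℝ)⁻¹ ≤ ENNReal.ofReal (s ^ d) ^ (d : ℝ)⁻¹ := by gcongr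
      _ = ENNReal.ofReal s := by
        rw [ENNReal.ofReal_rpow_of_nonneg (by positivity) (by positivity),
          Real.pow_rpow_inv_natCast hs (by omega)]
  have hI : Integrable F := hF.continuous.integrable_of_hasCompactSupport hc
  have hIg : Integrable (gradient F) :=
    (continuous_gradient hF).integrable_of_hasCompactSupport hc.gradient
  have e1 : eLpNorm F 1 volume = ENNReal.ofReal (∫ x, |F x|) := by
    rw [eLpNorm_one_eq_lintegral_enorm, ← ofReal_integral_norm_eq_lintegral_enorm hI]; rfl
  have e2 : eLpNorm (fderiv ℝ F) 1 volume = ENNReal.ofReal (∫ x, ‖gradient F x‖) := by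
    rw [ofReal_integral_norm_eq_lintegral_enorm hIg, eLpNorm_one_eq_lintegral_enorm]
    refine lintegral_congr fun x => ?_
    rw [← ofReal_norm, ← ofReal_norm, norm_gradient_eq]
  have h3 := h2.trans (mul_le_mul_left h1 _)
  rw [e1, e2, ← ENNReal.ofReal_coe_nnreal, ← ENNReal.ofReal_mul C.coe_nonneg, ← ENNReal.ofReal_mul
    (mul_nonneg C.coe_nonneg (integral_nonneg fun x => norm_nonneg _))] at h3
  have h4 := (ENNReal.ofReal_le_ofReal_iff (mul_nonneg (mul_nonneg C.coe_nonneg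
    (integral_nonneg fun x => norm_nonneg _)) hs)).1 h3
  calc _ ≤ _ := h4
    _ = _ := by ring

/-- A Faber-Krahn inequality: a small support forces a large Dirichlet energy. -/
theorem exists_integral_sq_le_of_support (hd : 2 ≤ d) : ∃ C : ℝ, 0 < C ∧
    ∀ (φ : Rd d → ℝ) (s : ℝ), ContDiff ℝ 1 φ → HasCompactSupport φ → 0 ≤ s →
      volume (Function.support φ) ≤ ENNReal.ofReal (s ^ d) →
      ∫ x, φ x ^ 2 ≤ C * s ^ 2 * ∫ x, ‖gradient φ x‖ ^ 2 := by
  obtain ⟨C, hC, h⟩ := exists_integral_abs_le_of_support hd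
  refine ⟨4 * C ^ 2 + 1, by positivity, fun φ s hφ hc hs hvol => ?_⟩
  have hF := h (fun x => φ x * φ x) s (hφ.mul hφ) hc.mul_left hs
    ((measure_mono (Function.support_mul_subset_left φ φ)).trans hvol)
  have hφc := hφ.continuous
  have hgφ := continuous_gradient hφ
  have I1 : Integrable fun x => φ x ^ 2 :=
    integrable_of_eq_zero_of_cutoff (by fun_prop) hc fun x hx => by simp [hx]
  have I2 : Integrable fun x => ‖gradient φ x‖ ^ 2 :=
    Continuous.integrable_of_hasCompactSupport (by fun_prop)
      (hc.gradient.mono fun x hx h0 => hx (by simp [h0]))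
  have hg : ∀ x, ‖gradient (fun x => φ x * φ x) x‖ = 2 * |φ x| * ‖gradient φ x‖ := fun x => by
    have := hφ.differentiable (by norm_num) x
    rw [gradient_mul_apply this this, ← add_smul, norm_smul, Real.norm_eq_abs, ← two_mul, abs_mul,
      abs_two]
  have h2 : C * s * ∫ x, ‖gradient (fun x => φ x * φ x) x‖ ≤
      1 / 2 * (∫ x, φ x ^ 2) + 2 * C ^ 2 * s ^ 2 * ∫ x, ‖gradient φ x‖ ^ 2 := by
    rw [← integral_const_mul, ← integral_const_mul, ← integral_const_mul,
      ← integral_add (I1.const_mul _) (I2.const_mul _)]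
    refine integral_mono (Integrable.const_mul ?_ _) ((I1.const_mul _).add (I2.const_mul _))
      fun x => ?_
    · simp only [hg]
      exact integrable_of_eq_zero_of_cutoff (by fun_prop) hc fun x hx => by simp [hx]
    · simp only [hg]
      rw [← sq_abs (φ x)]
      nlinarith [sq_nonneg (|φ x| - 2 * C * s * ‖gradient φ x‖)]
  have h3 : ∫ x, |φ x * φ x| = ∫ x, φ x ^ 2 :=
    integral_congr_ae (Filter.Eventually.of_forall fun x => by simp [sq])
  rw [h3] at hF
  have h4 : 0 ≤ s ^ 2 * ∫ x, ‖gradient φ x‖ ^ 2 :=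
    mul_nonneg (sq_nonneg _) (integral_nonneg fun x => by positivity)
  linarith

theorem excess_anti {u : Rd d → ℝ} {k l : ℝ} (h : k ≤ l) (x : Rd d) : excess u l x ≤ excess u k x :=
  max_le_max (by linarith) le_rfl

theorem setIntegral_excess_le {u : Rd d → ℝ} (hu : Continuous u) (n : ℕ) {k l r R : ℝ} (h : k ≤ l)
    (hr : r ≤ R) (x₀ : Rd d) : ∫ x in ball x₀ r, (excess u l x ^ (n + 2)) ^ 2 ≤
      ∫ x in ball x₀ R, (excess u k x ^ (n + 2)) ^ 2 := by
  have hc1 := continuous_excess hu k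
  have hc2 := continuous_excess hu l
  refine (setIntegral_mono_on (Continuous.integrableOn_ball' (by fun_prop) _ _)
    (Continuous.integrableOn_ball' (by fun_prop) _ _) measurableSet_ball (g := fun x =>
      (excess u k x ^ (n + 2)) ^ 2) fun x _ => ?_).trans
    (setIntegral_mono_set (Continuous.integrableOn_ball' (by fun_prop) _ _)
      (Filter.Eventually.of_forall fun x => by positivity) (ball_subset_ball hr).eventuallyLE)
  have := excess_nonneg u l x
  have := excess_anti h x (u := u)
  gcongr

/-- Chebyshev's inequality for the part of a ball where `u` exceeds a level `l > k`. -/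
theorem measure_superlevel_le {u : Rd d → ℝ} (hu : Continuous u) (n : ℕ) {k l r : ℝ} (h : k < l)
    (x₀ : Rd d) : volume.real (ball x₀ r ∩ {x | l < u x}) * ((l - k) ^ (n + 2)) ^ 2 ≤
      ∫ x in ball x₀ r, (excess u k x ^ (n + 2)) ^ 2 := by
  have hc1 := continuous_excess hu k
  have hm : MeasurableSet (ball x₀ r ∩ {x | l < u x}) :=
    measurableSet_ball.inter (isOpen_lt continuous_const hu).measurableSet
  have hfin : volume (ball x₀ r ∩ {x | l < u x}) ≠ ⊤ :=
    ((measure_mono Set.inter_subset_left).trans_lt measure_ball_lt_top).ne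
  calc volume.real (ball x₀ r ∩ {x | l < u x}) * ((l - k) ^ (n + 2)) ^ 2
      = ∫ _ in ball x₀ r ∩ {x | l < u x}, ((l - k) ^ (n + 2)) ^ 2 := by
        rw [setIntegral_const, smul_eq_mul]
    _ ≤ ∫ x in ball x₀ r ∩ {x | l < u x}, (excess u k x ^ (n + 2)) ^ 2 := by
        refine setIntegral_mono_on (integrableOn_const hfin)
          ((Continuous.integrableOn_ball' (by fun_prop) x₀ r).mono_set Set.inter_subset_left) hm
          fun x hx => ?_
        have hx2 : l < u x := hx.2
        have : l - k ≤ excess u k x := le_trans (by linarith) (le_max_left _ _)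
        have : 0 ≤ l - k := by linarith
        gcongr
    _ ≤ _ := setIntegral_mono_set (Continuous.integrableOn_ball' (by fun_prop) _ _)
      (Filter.Eventually.of_forall fun x => by positivity) Set.inter_subset_left.eventuallyLE

/-- One step of De Giorgi's iteration: from a ball of radius `R` and the level `k` to the radius
`r` and the level `l`. -/
theorem exists_degiorgi_step (hd : 2 ≤ d) (n : ℕ) {K : ℝ} (hK : 0 ≤ K) : ∃ C : ℝ, 0 < C ∧
    ∀ (u : Rd d → ℝ) (A : ℝ), 0 ≤ A → ContDiff ℝ 1 u → SatisfiesCaccioppoli n K A u →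
    ∀ (x₀ : Rd d) (r R k l s : ℝ), 0 < r → r < R → R ≤ 2 → k < l → A * (R - r) ^ 2 ≤ l - k → 0 ≤ s →
      volume.real (ball x₀ R ∩ {x | l < u x}) ≤ s ^ d →
      ∫ x in ball x₀ r, (excess u l x ^ (n + 2)) ^ 2 ≤
        C * (s / (R - r)) ^ 2 * ∫ x in ball x₀ R, (excess u k x ^ (n + 2)) ^ 2 := by
  obtain ⟨C, hC, hFK⟩ := exists_integral_sq_le_of_support hd
  obtain ⟨L, hL1, hL⟩ := exists_cutoff d
  refine ⟨C * (10 * K + 8 * L ^ 2), by positivity,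
    fun u A hA hu hcac x₀ r R k l s hr hrR hR hkl hAR hs hvol => ?_⟩
  obtain ⟨η, hη⟩ := hL x₀ r ((r + R) / 2) hr (by linarith)
  have hRr : 0 < R - r := by linarith
  have hlk : 0 < l - k := by linarith
  have hw := contDiff_excess_pow hu l n
  have hwc := hw.continuous
  have hsupp : Function.support (fun x => excess u l x ^ (n + 2) * η x) ⊆
      ball x₀ R ∩ {x | l < u x} := fun x hx => by
    rw [Function.mem_support, mul_ne_zero_iff] at hx
    refine ⟨?_, ?_⟩
    · by_contra hxR
      exact hx.2 (hη.eq_zero x fun h => hxR (ball_subset_ball (by linarith) h))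
    · by_contra hxl
      simp only [Set.mem_ofPred_eq, not_lt] at hxl
      exact hx.1 (by rw [excess, max_eq_right (by linarith), zero_pow (by omega)])
  have hvol2 : volume (Function.support (fun x => excess u l x ^ (n + 2) * η x)) ≤
      ENNReal.ofReal (s ^ d) := by
    refine (measure_mono hsupp).trans ?_
    rw [← ENNReal.ofReal_toReal (((measure_mono Set.inter_subset_left).trans_lt
      measure_ball_lt_top).ne : volume (ball x₀ R ∩ {x | l < u x}) ≠ ⊤)]
    exact ENNReal.ofReal_le_ofReal hvol
  have h1 := hFK _ s (hw.mul hη.contDiff) hη.hasCompactSupport.mul_left hs hvol2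
  have h2 := hη.integral_gradient_mul_sq_le hw
  have h3 := hcac.level hK hA hu.continuous (x₀ := x₀) (r := (r + R) / 2) (R := R) (k := l)
    (h' := k) (by linarith) (by linarith) hR hkl
  have h4 := hη.setIntegral_le_integral_mul (f := fun x => (excess u l x ^ (n + 2)) ^ 2)
    (by fun_prop) fun x => by positivity
  have h5 := setIntegral_excess_le hu.continuous n hkl.le (show (r + R) / 2 ≤ R by linarith) x₀
  have e0 : ∫ x, η x ^ 2 * (excess u l x ^ (n + 2)) ^ 2 =
      ∫ x, (excess u l x ^ (n + 2) * η x) ^ 2 :=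
    integral_congr_ae (Filter.Eventually.of_forall fun x => by simp only [mul_pow]; ring)
  rw [e0] at h4
  have e1 : (L / ((r + R) / 2 - r)) ^ 2 = 4 * L ^ 2 * (1 / (R - r) ^ 2) := by
    rw [show (r + R) / 2 - r = (R - r) / 2 by ring, div_pow, div_pow]
    field_simp
    norm_num
  have e2 : 1 / (R - (r + R) / 2) ^ 2 = 4 * (1 / (R - r) ^ 2) := by
    rw [show R - (r + R) / 2 = (R - r) / 2 by ring, div_pow]
    field_simp
    norm_num
  have e3 : A / (l - k) ≤ 1 / (R - r) ^ 2 := by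
    rw [div_le_div_iff₀ hlk (by positivity)]; linarith
  rw [e1] at h2
  rw [e2] at h3
  have e4 : (s / (R - r)) ^ 2 = s ^ 2 * (1 / (R - r) ^ 2) := by rw [div_pow]; ring
  rw [e4]
  set i := 1 / (R - r) ^ 2
  set U := ∫ x in ball x₀ R, (excess u k x ^ (n + 2)) ^ 2
  have hU : 0 ≤ U := setIntegral_nonneg measurableSet_ball fun x _ => by positivity
  have hi : 0 ≤ i := by positivity
  have h6 : ∫ x, ‖gradient (fun y => excess u l y ^ (n + 2) * η y) x‖ ^ 2 ≤
      (10 * K + 8 * L ^ 2) * (i * U) := by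
    have a1 : K * (4 * i + A / (l - k)) * U ≤ K * (4 * i + i) * U := by gcongr
    have a2 : 4 * L ^ 2 * i * ∫ x in ball x₀ ((r + R) / 2), (excess u l x ^ (n + 2)) ^ 2 ≤
      4 * L ^ 2 * i * U := by gcongr
    linarith
  calc _ ≤ _ := h4
    _ ≤ _ := h1
    _ ≤ C * s ^ 2 * ((10 * K + 8 * L ^ 2) * (i * U)) := by gcongr
    _ = _ := by ring

/-- **De Giorgi's first lemma**: if the part of a ball where `u` exceeds the level `k` is a small
fraction of the ball, then `u` stays well below its upper bound on the concentric ball of half the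
radius. -/
theorem exists_degiorgi_small_superlevel (hd : 2 ≤ d) (n : ℕ) {K : ℝ} (hK : 0 ≤ K) :
    ∃ ε : ℝ, 0 < ε ∧
    ∀ (u : Rd d → ℝ) (A : ℝ), 0 ≤ A → ContDiff ℝ 1 u → SatisfiesCaccioppoli n K A u →
    ∀ (x₀ : Rd d) (R k H : ℝ), 0 < R → R ≤ 2 → 0 < H → A * R ^ 2 ≤ H →
      (∀ x ∈ ball x₀ R, u x ≤ k + 2 * H) →
      volume.real (ball x₀ R ∩ {x | k < u x}) ≤ (ε * R) ^ d →
      ∀ x ∈ ball x₀ (R / 2), u x ≤ k + H := by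
  obtain ⟨C, hC, hstep⟩ := exists_degiorgi_step hd n hK
  -- the rate `τ` beats the growth of the constants in the iteration, of order `(4 Q ^ 2) ^ j`
  set Q : ℝ := 4 ^ (n + 2) with hQ
  have hQ1 : 1 ≤ Q := one_le_pow₀ (by norm_num)
  set τ : ℝ := 1 / (2 * Q) with hτ
  have hτ0 : 0 < τ := by positivity
  have hτ1 : τ < 1 := by rw [hτ, div_lt_one (by positivity)]; linarith
  set ε := √(τ ^ d / (16 * C * Q ^ 4)) with hε
  have hε0 : 0 < ε := Real.sqrt_pos.2 (by positivity)
  have hεs : 16 * C * Q ^ 4 * ε ^ 2 = τ ^ d := by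
    rw [hε, Real.sq_sqrt (by positivity)]; field_simp
  refine ⟨ε, hε0, fun u A hA hu hcac x₀ R k H hR hR2 hH hAR hbd hvol => ?_⟩
  set r : ℕ → ℝ := fun j => R / 2 * (1 + (1 / 2) ^ j) with hr
  set l : ℕ → ℝ := fun j => k + H * (1 - (1 / 2) ^ j) with hl
  set U : ℕ → ℝ := fun j => ∫ x in ball x₀ (r j), (excess u (l j) x ^ (n + 2)) ^ 2 with hU
  have hrR : ∀ j, r j ≤ R := fun j => by
    have : (1 / 2 : ℝ) ^ j ≤ 1 := pow_le_one₀ (by norm_num) (by norm_num)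
    simp only [hr]; nlinarith
  have hrR' : ∀ j, R / 2 ≤ r j := fun j => by
    have : 0 < (1 / 2 : ℝ) ^ j := by positivity
    simp only [hr]; nlinarith
  have hlH : ∀ j, l j ≤ k + H := fun j => by
    have : 0 < (1 / 2 : ℝ) ^ j := by positivity
    simp only [hl]; nlinarith
  have hrd : ∀ j, r j - r (j + 1) = R * (1 / 4) * (1 / 2) ^ j := fun j => by
    simp only [hr, pow_succ]; ring
  have hld : ∀ j, l (j + 1) - l j = H * (1 / 2) ^ (j + 1) := fun j => by
    simp only [hl, pow_succ]; ring
  have decay : ∀ j, U j ≤ Q * (H ^ (n + 2)) ^ 2 * (ε * R * τ ^ j) ^ d := fun j => by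
    induction j with
    | zero =>
      have hc := continuous_excess hu.continuous k
      have hm : MeasurableSet (ball x₀ R ∩ {x | k < u x}) :=
        measurableSet_ball.inter (isOpen_lt continuous_const hu.continuous).measurableSet
      have hfin : volume (ball x₀ R ∩ {x | k < u x}) ≠ ⊤ :=
        ((measure_mono Set.inter_subset_left).trans_lt measure_ball_lt_top).ne
      have e0 : U 0 = ∫ x in ball x₀ R, (excess u k x ^ (n + 2)) ^ 2 := by
        have h1 : r 0 = R := by simp only [hr, pow_zero]; ring
        have h2 : l 0 = k := by simp [hl]
        simp only [hU, h1, h2]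
      have e1 : ∫ x in ball x₀ R, (excess u k x ^ (n + 2)) ^ 2 =
          ∫ x in ball x₀ R ∩ {x | k < u x}, (excess u k x ^ (n + 2)) ^ 2 := by
        refine (setIntegral_eq_of_subset_of_forall_sdiff_eq_zero measurableSet_ball
          Set.inter_subset_left fun x hx => ?_)
        have : u x ≤ k := by
          by_contra h
          exact hx.2 ⟨hx.1, not_le.1 h⟩
        rw [excess, max_eq_right (by linarith)]; simp
      have e2 : ∫ x in ball x₀ R ∩ {x | k < u x}, (excess u k x ^ (n + 2)) ^ 2 ≤
          ∫ _ in ball x₀ R ∩ {x | k < u x}, ((2 * H) ^ (n + 2)) ^ 2 := by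
        refine setIntegral_mono_on ((Continuous.integrableOn_ball' (by fun_prop) x₀ R).mono_set
          Set.inter_subset_left) (integrableOn_const hfin) hm fun x hx => ?_
        have h1 : excess u k x ≤ 2 * H := max_le (by linarith [hbd x hx.1]) (by linarith)
        have h0 := excess_nonneg u k x
        gcongr
      rw [setIntegral_const, smul_eq_mul] at e2
      rw [e0, e1]
      calc _ ≤ _ := e2
        _ ≤ (ε * R) ^ d * ((2 * H) ^ (n + 2)) ^ 2 := by gcongr
        _ = _ := by
          have h4 : Q = (2 ^ (n + 2)) ^ 2 := by
            rw [hQ, ← pow_mul, mul_comm, pow_mul]; norm_num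
          rw [h4, mul_pow 2 H]
          simp only [pow_zero, mul_one]
          ring
    | succ j ih =>
      set s := Q ^ (j + 2) * (ε * R * τ ^ j) with hs
      have hH' : 0 < H * (1 / 2) ^ (j + 1) := by positivity
      have hv : volume.real (ball x₀ (r j) ∩ {x | l (j + 1) < u x}) ≤ s ^ d := by
        have hch := measure_superlevel_le hu.continuous n (r := r j)
          (show l j < l (j + 1) by have := hld j; linarith) x₀
        rw [hld] at hch
        have h1 := hch.trans ih
        have e1 : ((H * (1 / 2 : ℝ) ^ (j + 1)) ^ (n + 2)) ^ 2 * Q ^ (j + 1) =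
            (H ^ (n + 2)) ^ 2 := by
          have : ((1 / 2 : ℝ) ^ (j + 1)) ^ 2 * 4 ^ (j + 1) = 1 := by
            rw [← pow_mul, mul_comm (j + 1) 2, pow_mul, ← mul_pow]; norm_num
          have h2 : (((1 / 2 : ℝ) ^ (j + 1)) ^ (n + 2)) ^ 2 * (4 ^ (n + 2)) ^ (j + 1) = 1 := by
            calc _ = (((1 / 2 : ℝ) ^ (j + 1)) ^ 2 * 4 ^ (j + 1)) ^ (n + 2) := by
                  rw [mul_pow, ← pow_mul, ← pow_mul, ← pow_mul, ← pow_mul, ← pow_mul, ← pow_mul]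
                  congr 2 <;> ring
              _ = 1 := by rw [this, one_pow]
          rw [mul_pow, mul_pow, mul_assoc, hQ, h2, mul_one]
        have h2 : volume.real (ball x₀ (r j) ∩ {x | l (j + 1) < u x}) ≤
            Q ^ (j + 2) * (ε * R * τ ^ j) ^ d := by
          have hpos : 0 < ((H * (1 / 2 : ℝ) ^ (j + 1)) ^ (n + 2)) ^ 2 := by positivity
          refine le_of_mul_le_mul_right (h1.trans (le_of_eq ?_)) hpos
          rw [← e1]; ring
        refine h2.trans ?_
        rw [hs, mul_pow (Q ^ (j + 2))]
        gcongr
        exact le_self_pow₀ (one_le_pow₀ hQ1) (by omega)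
      have hst := hstep u A hA hu hcac x₀ (r (j + 1)) (r j) (l j) (l (j + 1)) s
        (by have := hrR' (j + 1); linarith)
        (by have := hrd j; have : 0 < R * (1 / 4) * (1 / 2) ^ j := by positivity
            linarith)
        ((hrR j).trans hR2) (by have := hld j; linarith)
        (by
          rw [hrd, hld]
          have : (1 / 2 : ℝ) ^ j ≤ 1 := pow_le_one₀ (by norm_num) (by norm_num)
          have h0 : 0 < (1 / 2 : ℝ) ^ j := by positivity
          calc A * (R * (1 / 4) * (1 / 2) ^ j) ^ 2 =
                A * R ^ 2 * (1 / 16 * (1 / 2) ^ j * (1 / 2) ^ j) := by ring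
            _ ≤ H * (1 / 2 * (1 / 2) ^ j * 1) := by gcongr; norm_num
            _ = _ := by rw [pow_succ]; ring)
        (by positivity) hv
      have e2 : C * (s / (r j - r (j + 1))) ^ 2 = τ ^ d := by
        have e3 : s / (r j - r (j + 1)) = 4 * Q ^ 2 * ε * (2 * Q * τ) ^ j := by
          rw [hrd, hs]
          have : (1 / 2 : ℝ) ^ j * 2 ^ j = 1 := by rw [← mul_pow]; norm_num
          rw [div_eq_iff (by positivity), mul_pow, mul_pow]
          linear_combination (-(Q ^ j * τ ^ j * Q ^ 2 * ε * R)) * this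
        rw [e3, hτ, mul_one_div_cancel (by positivity), one_pow, ← hεs]
        ring
      rw [e2] at hst
      calc U (j + 1) ≤ τ ^ d * U j := hst
        _ ≤ τ ^ d * (Q * (H ^ (n + 2)) ^ 2 * (ε * R * τ ^ j) ^ d) := by gcongr
        _ = _ := by rw [pow_succ τ j]; ring
  have hI : ∫ x in ball x₀ (R / 2), (excess u (k + H) x ^ (n + 2)) ^ 2 ≤ 0 := by
    have hlim : Filter.Tendsto (fun j : ℕ => Q * (H ^ (n + 2)) ^ 2 * (ε * R * τ ^ j) ^ d)
        Filter.atTop (nhds (Q * (H ^ (n + 2)) ^ 2 * (ε * R * 0) ^ d)) :=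
      (((tendsto_pow_atTop_nhds_zero_of_lt_one hτ0.le hτ1).const_mul _).pow _).const_mul _
    rw [mul_zero, zero_pow (by omega), mul_zero] at hlim
    exact ge_of_tendsto' hlim fun j =>
      (setIntegral_excess_le hu.continuous n (hlH j) (hrR' j) x₀).trans (decay j)
  have hc := continuous_excess hu.continuous (k + H)
  have hz := (setIntegral_eq_zero_iff_of_nonneg_ae
    (Filter.Eventually.of_forall fun x => by positivity)
    (Continuous.integrableOn_ball' (f := fun x => (excess u (k + H) x ^ (n + 2)) ^ 2)
      (by fun_prop) x₀ (R / 2))).1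
    (le_antisymm hI (setIntegral_nonneg measurableSet_ball fun x _ => by positivity))
  have heq := Measure.eqOn_open_of_ae_eq hz isOpen_ball (by fun_prop) (by fun_prop)
  intro x hx
  have h0 := heq hx
  simp only [Pi.zero_apply] at h0
  have h1 : excess u (k + H) x = 0 := by
    by_contra h
    exact absurd h0 (by positivity)
  have h2 : u x - (k + H) ≤ excess u (k + H) x := le_max_left _ _
  linarith

end SmallLevelSets

/-! ### A Poincaré inequality -/

section Poincare

variable {d : ℕ}

open scoped ENNReal

theorem lintegral_comp_smul_add_le {G : Rd d → ℝ≥0∞} (hG : Measurable G) {c : ℝ} (hc : 1 / 2 ≤ c)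
    (v : Rd d) : ∫⁻ x, G (c • x + v) ≤ 2 ^ d * ∫⁻ x, G x := by
  have hc0 : 0 < c := by linarith
  have h1 : ∫⁻ x, G (c • x + v) = ∫⁻ z, G (z + v) ∂(Measure.map (c • ·) (volume : Measure (Rd d))) :=
    (lintegral_map (f := fun z => G (z + v)) (hG.comp (measurable_add_const v))
      (measurable_const_smul c)).symm
  rw [h1, Measure.map_addHaar_smul _ hc0.ne', lintegral_smul_measure,
    lintegral_add_right_eq_self (fun z => G z) v, finrank_euclideanSpace_fin, smul_eq_mul]
  gcongr
  rw [abs_of_pos (by positivity), ← inv_pow, ENNReal.ofReal_pow (by positivity)]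
  have : ENNReal.ofReal (c⁻¹) ≤ 2 := by
    rw [← ENNReal.ofReal_ofNat 2]
    refine ENNReal.ofReal_le_ofReal ?_
    rw [inv_le_comm₀ hc0 (by norm_num)]
    linarith
  gcongr

/-- Averaging `G` at the point dividing a segment in the ratio `t : 1 - t`. One of the weights `t` and
`1 - t` is at least `1 / 2`, and one changes variables in the endpoint carrying it. -/
theorem lintegral_lintegral_segment_le {G : Rd d → ℝ≥0∞} (hG : Measurable G) {t : ℝ}
    (B : Set (Rd d)) : ∫⁻ x in B, ∫⁻ y in B, G ((1 - t) • x + t • y) ≤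
      2 ^ d * volume B * ∫⁻ x, G x := by
  have aux : ∀ {c s : ℝ}, 1 / 2 ≤ c → ∫⁻ x in B, ∫⁻ y in B, G (c • y + s • x) ≤
      2 ^ d * volume B * ∫⁻ x, G x := fun {c s} hc => by
    calc ∫⁻ x in B, ∫⁻ y in B, G (c • y + s • x) ≤ ∫⁻ _ in B, 2 ^ d * ∫⁻ x, G x :=
          lintegral_mono fun x => (setLIntegral_le_lintegral _ _).trans
            (lintegral_comp_smul_add_le hG hc _)
      _ = _ := by rw [setLIntegral_const]; ring
  rcases le_total (1 / 2) t with ht | ht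
  · simp only [add_comm ((1 - t) • _)]
    exact aux ht
  · rw [lintegral_lintegral_swap (by
      refine Measurable.aemeasurable ?_
      exact hG.comp (by fun_prop))]
    exact aux (by linarith)

theorem enorm_sub_le_lintegral_segment {f : Rd d → ℝ} (hf : ContDiff ℝ 1 f) (x y : Rd d) :
    ‖f y - f x‖ₑ ≤ ‖y - x‖ₑ * ∫⁻ t in Set.Icc (0 : ℝ) 1, ‖fderiv ℝ f ((1 - t) • x + t • y)‖ₑ := by
  set γ : ℝ → ℝ := fun t => f ((1 - t) • x + t • y) with hγ
  have hγc : ContDiff ℝ 1 γ := hf.comp (by fun_prop)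
  have hd : ∀ t, deriv γ t = fderiv ℝ f ((1 - t) • x + t • y) (y - x) := fun t => by
    have h1 : HasDerivAt (fun t : ℝ => (1 - t) • x + t • y) (y - x) t := by
      have := (((hasDerivAt_id t).const_sub 1).smul_const x).add ((hasDerivAt_id t).smul_const y)
      refine this.congr_deriv ?_
      simp [sub_eq_neg_add]
    exact ((hf.differentiable (by norm_num) _).hasFDerivAt.comp_hasDerivAt t h1).deriv
  have h := enorm_sub_le_lintegral_deriv_of_contDiffOn_Icc hγc.contDiffOn (zero_le_one' ℝ)
  simp only [hγ, sub_self, zero_smul, one_smul, zero_add, sub_zero, add_zero] at h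
  refine h.trans ?_
  rw [← lintegral_const_mul' _ _ (by simp)]
  refine lintegral_mono fun t => ?_
  have := hd t
  simp only [hγ] at this
  rw [this, mul_comm]
  exact ContinuousLinearMap.le_opENorm _ _

/-- The Poincaré inequality behind `setIntegral_abs_le_of_half_zero`, for functions vanishing on an
arbitrary subset of the ball. -/
theorem measure_mul_lintegral_le {f : Rd d → ℝ} (hf : ContDiff ℝ 1 f) (x₀ : Rd d) (R : ℝ)
    {Z : Set (Rd d)} (hZ : Z ⊆ ball x₀ R) (hZ0 : ∀ x ∈ Z, f x = 0) :
    volume Z * ∫⁻ x in ball x₀ R, ‖f x‖ₑ ≤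
      ENNReal.ofReal (2 * R) *
        (2 ^ d * volume (ball x₀ R) * ∫⁻ x in ball x₀ R, ‖fderiv ℝ f x‖ₑ) := by
  set B := ball x₀ R with hB
  set G : Rd d → ℝ≥0∞ := B.indicator fun x => ‖fderiv ℝ f x‖ₑ with hG_def
  have hG : Measurable G :=
    ((hf.continuous_fderiv (by norm_num)).enorm.measurable).indicator measurableSet_ball
  have hpt : ∀ x ∈ B, ∀ y ∈ Z, ‖f x‖ₑ ≤ ENNReal.ofReal (2 * R) *
      ∫⁻ t in Set.Icc (0 : ℝ) 1, G ((1 - t) • x + t • y) := fun x hx y hy => by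
    have h := enorm_sub_le_lintegral_segment hf x y
    rw [hZ0 y hy, zero_sub, enorm_neg] at h
    refine h.trans ?_
    gcongr ?_ * ?_
    · rw [← ofReal_norm]
      refine ENNReal.ofReal_le_ofReal ?_
      have h1 := mem_ball_iff_norm.1 hx
      have h2 := mem_ball_iff_norm.1 (hZ hy)
      calc ‖y - x‖ = ‖(y - x₀) - (x - x₀)‖ := by congr 1; abel
        _ ≤ ‖y - x₀‖ + ‖x - x₀‖ := norm_sub_le _ _
        _ ≤ 2 * R := by linarith
    · refine setLIntegral_mono' measurableSet_Icc fun t ht => ?_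
      have hm : (1 - t) • x + t • y ∈ B :=
        (convex_ball x₀ R) hx (hZ hy) (by linarith [ht.2]) ht.1 (by ring)
      rw [hG_def, Set.indicator_of_mem hm]
  have hmeas3 : Measurable fun p : (Rd d × ℝ) × Rd d => G ((1 - p.1.2) • p.1.1 + p.1.2 • p.2) :=
    hG.comp (by fun_prop)
  calc volume Z * ∫⁻ x in B, ‖f x‖ₑ = ∫⁻ x in B, ∫⁻ _ in Z, ‖f x‖ₑ := by
        simp only [setLIntegral_const]
        rw [lintegral_mul_const _ hf.continuous.enorm.measurable, mul_comm]
    _ ≤ ∫⁻ x in B, ∫⁻ y in B, ENNReal.ofReal (2 * R) *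
          ∫⁻ t in Set.Icc (0 : ℝ) 1, G ((1 - t) • x + t • y) := by
        refine setLIntegral_mono' measurableSet_ball fun x hx => ?_
        refine le_trans ?_ (lintegral_mono_set hZ)
        refine setLIntegral_mono (Measurable.const_mul ?_ _) fun y hy => hpt x hx y hy
        exact Measurable.lintegral_prod_right' (f := fun p : Rd d × ℝ =>
          G ((1 - p.2) • x + p.2 • p.1)) (hG.comp (by fun_prop))
    _ = ENNReal.ofReal (2 * R) * ∫⁻ x in B, ∫⁻ y in B,
          ∫⁻ t in Set.Icc (0 : ℝ) 1, G ((1 - t) • x + t • y) := by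
        simp only [lintegral_const_mul' _ _ ENNReal.ofReal_ne_top]
    _ = ENNReal.ofReal (2 * R) * ∫⁻ t in Set.Icc (0 : ℝ) 1, ∫⁻ x in B, ∫⁻ y in B,
          G ((1 - t) • x + t • y) := by
        congr 1
        rw [lintegral_lintegral_swap (f := fun t x => ∫⁻ y in B, G ((1 - t) • x + t • y))]
        · refine lintegral_congr fun x => ?_
          rw [lintegral_lintegral_swap]
          exact (hG.comp (f := fun p : Rd d × ℝ => (1 - p.2) • x + p.2 • p.1)
            (by fun_prop)).aemeasurable
        · refine Measurable.aemeasurable ?_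
          exact Measurable.lintegral_prod_right' (f := fun p : (ℝ × Rd d) × Rd d =>
            G ((1 - p.1.1) • p.1.2 + p.1.1 • p.2)) (hG.comp (by fun_prop))
    _ ≤ ENNReal.ofReal (2 * R) * ∫⁻ _ in Set.Icc (0 : ℝ) 1, 2 ^ d * volume B * ∫⁻ x, G x := by
        gcongr with t
        exact lintegral_lintegral_segment_le hG B
    _ = _ := by
        rw [setLIntegral_const, Real.volume_Icc, sub_zero, ENNReal.ofReal_one, mul_one, hG_def,
          lintegral_indicator measurableSet_ball]

/-- A Poincaré inequality for functions vanishing on at least half of a ball. It is obtained by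
averaging the fundamental theorem of calculus over all segments joining a point of the ball to a
zero of the function. -/
theorem setIntegral_abs_le_of_half_zero {f : Rd d → ℝ} (hf : ContDiff ℝ 1 f) (x₀ : Rd d) {R : ℝ}
    (hR : 0 < R) {Z : Set (Rd d)} (hZ : Z ⊆ ball x₀ R) (hZ0 : ∀ x ∈ Z, f x = 0)
    (hhalf : volume.real (ball x₀ R) ≤ 2 * volume.real Z) :
    ∫ x in ball x₀ R, |f x| ≤ 4 * R * 2 ^ d * ∫ x in ball x₀ R, ‖gradient f x‖ := by
  have h := measure_mul_lintegral_le hf x₀ R hZ hZ0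
  have I1 : IntegrableOn f (ball x₀ R) := hf.continuous.integrableOn_ball' x₀ R
  have I2 : IntegrableOn (fderiv ℝ f) (ball x₀ R) :=
    ((hf.continuous_fderiv (by norm_num)).locallyIntegrable.integrableOn_isCompact
      (isCompact_closedBall x₀ R)).mono_set ball_subset_closedBall
  have hB : volume (ball x₀ R) ≠ ⊤ := measure_ball_lt_top.ne
  have hZt : volume Z ≠ ⊤ := ((measure_mono hZ).trans_lt measure_ball_lt_top).ne
  rw [← ofReal_integral_norm_eq_lintegral_enorm I1, ← ofReal_integral_norm_eq_lintegral_enorm I2,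
    ← ofReal_measureReal hB, ← ofReal_measureReal hZt, ← ENNReal.ofReal_mul measureReal_nonneg,
    show (2 : ℝ≥0∞) ^ d = ENNReal.ofReal (2 ^ d) by
      rw [ENNReal.ofReal_pow (by norm_num), ENNReal.ofReal_ofNat],
    ← ENNReal.ofReal_mul (by positivity), ← ENNReal.ofReal_mul (by positivity),
    ← ENNReal.ofReal_mul (by positivity), ENNReal.ofReal_le_ofReal_iff (by positivity)] at h
  have hBpos : 0 < volume.real (ball x₀ R) := by
    rw [measureReal_def, ENNReal.toReal_pos_iff]
    exact ⟨measure_ball_pos _ _ hR, measure_ball_lt_top⟩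
  simp only [norm_gradient_eq]
  set F := ∫ x in ball x₀ R, ‖f x‖ with hF
  have hF0 : 0 ≤ F := integral_nonneg fun x => norm_nonneg _
  change F ≤ _
  set D := ∫ x in ball x₀ R, ‖fderiv ℝ f x‖
  refine le_of_mul_le_mul_left ?_ hBpos
  nlinarith

/-- De Giorgi's isoperimetric inequality: to pass from the level `k` to the level `h`, a function
spends gradient on the strip in between. It is the Poincaré inequality for a smooth truncation
of `u` between the two levels. -/
theorem measure_superlevel_mul_le (d : ℕ) : ∃ C : ℝ, 0 < C ∧
    ∀ (u : Rd d → ℝ), ContDiff ℝ 1 u → ∀ (x₀ : Rd d) (R k h : ℝ), 0 < R → k < h →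
      volume.real (ball x₀ R) ≤ 2 * volume.real (ball x₀ R ∩ {x | u x ≤ k}) →
      (h - k) * volume.real (ball x₀ R ∩ {x | h < u x}) ≤
        C * R * ∫ x in ball x₀ R ∩ {x | k < u x ∧ u x ≤ h}, ‖gradient u x‖ := by
  obtain ⟨L, hL1, hL⟩ := exists_bound_deriv_smoothTransition
  have hL0 : 0 < L := by linarith
  refine ⟨4 * 2 ^ d * L, by positivity, fun u hu x₀ R k h hR hkh hhalf => ?_⟩
  have hd0 : 0 < h - k := by linarith
  have huc := hu.continuous
  have hgu := continuous_gradient hu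
  set S : Rd d → ℝ := fun x => Real.smoothTransition ((u x - k) / (h - k)) with hS
  have hSc : ContDiff ℝ 1 S :=
    Real.smoothTransition.contDiff.comp ((hu.sub contDiff_const).div_const _)
  have hgS : ∀ x, gradient S x =
      (deriv Real.smoothTransition ((u x - k) / (h - k)) * (h - k)⁻¹) • gradient u x := fun x => by
    refine gradient_comp_apply (h := fun s => Real.smoothTransition ((s - k) / (h - k))) ?_
      (hu.differentiable (by norm_num) x)
    have h1 : HasDerivAt (fun s : ℝ => (s - k) / (h - k)) ((h - k)⁻¹) (u x) := by
      simpa using ((hasDerivAt_id (u x)).sub_const k).div_const (h - k)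
    exact ((Real.smoothTransition.contDiff (n := 1)).differentiable (by norm_num)
      _).hasDerivAt.comp (u x) h1
  have hP := setIntegral_abs_le_of_half_zero hSc x₀ hR (Z := ball x₀ R ∩ {x | u x ≤ k})
    Set.inter_subset_left (fun x hx => Real.smoothTransition.zero_of_nonpos
      (div_nonpos_of_nonpos_of_nonneg (by have : u x ≤ k := hx.2; linarith) hd0.le)) hhalf
  have hm1 : MeasurableSet (ball x₀ R ∩ {x | h < u x}) :=
    measurableSet_ball.inter (isOpen_lt continuous_const huc).measurableSet
  have hm2 : MeasurableSet (ball x₀ R ∩ {x | k < u x ∧ u x ≤ h}) :=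
    measurableSet_ball.inter ((isOpen_lt continuous_const huc).measurableSet.inter
      (isClosed_le huc continuous_const).measurableSet)
  have hfin : volume (ball x₀ R ∩ {x | h < u x}) ≠ ⊤ :=
    ((measure_mono Set.inter_subset_left).trans_lt measure_ball_lt_top).ne
  have hSa : Continuous fun x => |S x| := hSc.continuous.abs
  have h1 : volume.real (ball x₀ R ∩ {x | h < u x}) ≤ ∫ x in ball x₀ R, |S x| := by
    calc volume.real (ball x₀ R ∩ {x | h < u x}) = ∫ _ in ball x₀ R ∩ {x | h < u x}, (1 : ℝ) := by
          rw [setIntegral_const, smul_eq_mul, mul_one]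
      _ = ∫ x in ball x₀ R ∩ {x | h < u x}, |S x| := by
          refine setIntegral_congr_fun hm1 fun x hx => ?_
          have h2 : h < u x := hx.2
          simp only [hS]
          rw [Real.smoothTransition.one_of_one_le, abs_one]
          rw [le_div_iff₀ hd0]; linarith
      _ ≤ _ := setIntegral_mono_set (hSa.integrableOn_ball' _ _)
        (Filter.Eventually.of_forall fun x => abs_nonneg _) Set.inter_subset_left.eventuallyLE
  have h2 : ∫ x in ball x₀ R, ‖gradient S x‖ ≤
      L * (h - k)⁻¹ * ∫ x in ball x₀ R ∩ {x | k < u x ∧ u x ≤ h}, ‖gradient u x‖ := by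
    rw [setIntegral_eq_of_subset_of_forall_sdiff_eq_zero (s := ball x₀ R ∩ {x | k < u x ∧ u x ≤ h})
      measurableSet_ball Set.inter_subset_left, ← integral_const_mul]
    · refine setIntegral_mono_on (((continuous_gradient hSc).norm.integrableOn_ball' x₀ R).mono_set
        Set.inter_subset_left) (((hgu.norm.integrableOn_ball' x₀ R).mono_set
        Set.inter_subset_left).const_mul _) hm2 fun x _ => ?_
      rw [hgS, norm_smul, norm_mul, norm_inv, Real.norm_of_nonneg hd0.le]
      gcongr
      exact hL _
    · intro x hx
      have : deriv Real.smoothTransition ((u x - k) / (h - k)) = 0 := by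
        refine deriv_smoothTransition_eq_zero ?_
        by_contra hcon
        rw [not_or, not_le, not_le, lt_div_iff₀ hd0, div_lt_one hd0] at hcon
        exact hx.2 ⟨hx.1, by linarith [hcon.1], by linarith [hcon.2]⟩
      rw [hgS, this]; simp
  have h3 := h1.trans (hP.trans (mul_le_mul_of_nonneg_left h2 (by positivity)))
  calc (h - k) * volume.real (ball x₀ R ∩ {x | h < u x}) ≤ (h - k) * _ :=
        mul_le_mul_of_nonneg_left h3 hd0.le
    _ = _ := by field_simp

end Poincare

/-! ### Shrinking of superlevel sets -/

section ShrinkingLevelSets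

variable {d : ℕ}

theorem measureReal_ball_eq (x₀ : Rd d) {R : ℝ} (hR : 0 < R) :
    volume.real (ball x₀ R) = R ^ d * volume.real (ball (0 : Rd d) 1) := by
  rw [measureReal_def, measureReal_def, Measure.addHaar_ball_of_pos _ _ hR, ENNReal.toReal_mul,
    finrank_euclideanSpace_fin, ENNReal.toReal_ofReal (by positivity)]

/-- The Dirichlet energy of `u` itself above a level, in terms of the distance `2 q` of this level to
an upper bound of `u`. -/
theorem setIntegral_gradient_sq_superlevel_le {n : ℕ} {K A : ℝ} {u : Rd d → ℝ} (hK : 0 ≤ K)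
    (hA : 0 ≤ A) (hu : ContDiff ℝ 1 u) (hcac : SatisfiesCaccioppoli n K A u) {x₀ : Rd d}
    {R M q : ℝ} (hR : 0 < R) (hR1 : R ≤ 1) (hq : 0 < q) (hAR : A * R ^ 2 ≤ q)
    (hM : ∀ x ∈ ball x₀ (2 * R), u x ≤ M) :
    R ^ 2 * ∫ x in ball x₀ R ∩ {x | M - 2 * q < u x}, ‖gradient u x‖ ^ 2 ≤
      2 * K * 16 ^ (n + 2) * 2 ^ d * volume.real (ball (0 : Rd d) 1) * q ^ 2 * R ^ d := by
  have huc := hu.continuous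
  have hgu := continuous_gradient hu
  have hw := contDiff_excess_pow hu (M - 3 * q) n
  have hgw := continuous_gradient hw
  have he := continuous_excess huc (M - 4 * q)
  have h := hcac.level hK hA huc (x₀ := x₀) (r := R) (R := 2 * R) (k := M - 3 * q)
    (h' := M - 4 * q) hR (by linarith) (by linarith) (by linarith)
  rw [show 2 * R - R = R by ring, show M - 3 * q - (M - 4 * q) = q by ring] at h
  have hm : MeasurableSet (ball x₀ R ∩ {x | M - 2 * q < u x}) :=
    measurableSet_ball.inter (isOpen_lt continuous_const huc).measurableSet
  have h1 : (q ^ (n + 1)) ^ 2 * ∫ x in ball x₀ R ∩ {x | M - 2 * q < u x}, ‖gradient u x‖ ^ 2 ≤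
      ∫ x in ball x₀ R, ‖gradient (fun y => excess u (M - 3 * q) y ^ (n + 2)) x‖ ^ 2 := by
    rw [← integral_const_mul]
    refine (setIntegral_mono_on (IntegrableOn.mono_set (Continuous.integrableOn_ball'
      (by fun_prop) x₀ R) Set.inter_subset_left) (IntegrableOn.mono_set
      (Continuous.integrableOn_ball' (by fun_prop) x₀ R) Set.inter_subset_left) hm
      fun x hx => ?_).trans (setIntegral_mono_set (Continuous.integrableOn_ball' (by fun_prop) _ _)
      (Filter.Eventually.of_forall fun x => sq_nonneg _) Set.inter_subset_left.eventuallyLE)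
    have hx2 : M - 2 * q < u x := hx.2
    have hqe : q ≤ excess u (M - 3 * q) x := le_trans (by linarith) (le_max_left _ _)
    rw [gradient_excess_pow hu, norm_smul, ← mul_pow, Real.norm_eq_abs, abs_of_nonneg
      (mul_nonneg (by positivity) (pow_nonneg (excess_nonneg u _ x) _))]
    have h2 : q ^ (n + 1) ≤ (n + 2 : ℝ) * excess u (M - 3 * q) x ^ (n + 1) := by
      calc q ^ (n + 1) = 1 * q ^ (n + 1) := (one_mul _).symm
        _ ≤ _ := by
          gcongr
          have : (0 : ℝ) ≤ n := by positivity
          linarith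
    gcongr
  have h2 : ∫ x in ball x₀ (2 * R), (excess u (M - 4 * q) x ^ (n + 2)) ^ 2 ≤
      (2 * R) ^ d * volume.real (ball (0 : Rd d) 1) * ((4 * q) ^ (n + 2)) ^ 2 := by
    calc _ ≤ ∫ _ in ball x₀ (2 * R), ((4 * q) ^ (n + 2)) ^ 2 := by
          refine setIntegral_mono_on (Continuous.integrableOn_ball' (by fun_prop) _ _)
            (integrableOn_const measure_ball_lt_top.ne) measurableSet_ball fun x hx => ?_
          have h3 : excess u (M - 4 * q) x ≤ 4 * q :=
            max_le (by linarith [hM x hx]) (by linarith)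
          have h0 := excess_nonneg u (M - 4 * q) x
          gcongr
      _ = _ := by rw [setIntegral_const, smul_eq_mul, measureReal_ball_eq _ (by positivity)]
  have h3 : R ^ 2 * (1 / R ^ 2 + A / q) ≤ 2 := by
    have : A * R ^ 2 / q ≤ 1 := (div_le_one hq).2 hAR
    have e : R ^ 2 * (1 / R ^ 2 + A / q) = 1 + A * R ^ 2 / q := by field_simp
    linarith
  set D := ∫ x in ball x₀ R ∩ {x | M - 2 * q < u x}, ‖gradient u x‖ ^ 2
  set W := ∫ x in ball x₀ (2 * R), (excess u (M - 4 * q) x ^ (n + 2)) ^ 2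
  have hW : 0 ≤ W := setIntegral_nonneg measurableSet_ball fun x _ => by positivity
  refine le_of_mul_le_mul_left ?_ (show 0 < (q ^ (n + 1)) ^ 2 by positivity)
  calc (q ^ (n + 1)) ^ 2 * (R ^ 2 * D) = R ^ 2 * ((q ^ (n + 1)) ^ 2 * D) := by ring
    _ ≤ R ^ 2 * (K * (1 / R ^ 2 + A / q) * W) :=
        mul_le_mul_of_nonneg_left (h1.trans h) (by positivity)
    _ = R ^ 2 * (1 / R ^ 2 + A / q) * (K * W) := by ring
    _ ≤ 2 * (K * ((2 * R) ^ d * volume.real (ball (0 : Rd d) 1) * ((4 * q) ^ (n + 2)) ^ 2)) := by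
        gcongr
    _ = _ := by
        have e : (16 : ℝ) ^ (n + 2) = (4 ^ (n + 2)) ^ 2 := by
          rw [← pow_mul, mul_comm, pow_mul]; norm_num
        rw [mul_pow 2 R, mul_pow 4 q, e]
        ring

/-- **De Giorgi's second lemma**: if `u` is below `M - Ω` on half of a ball, then it is close to its
upper bound `M` only on a small part of the ball. -/
theorem exists_degiorgi_shrinking (d n : ℕ) {K : ℝ} (hK : 0 ≤ K) {θ : ℝ} (hθ : 0 < θ) :
    ∃ N : ℕ, ∀ (u : Rd d → ℝ) (A : ℝ), 0 ≤ A → ContDiff ℝ 1 u → SatisfiesCaccioppoli n K A u →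
    ∀ (x₀ : Rd d) (R M Ω : ℝ), 0 < R → R ≤ 1 → 0 < Ω → A * R ^ 2 ≤ Ω * (1 / 2) ^ N →
      (∀ x ∈ ball x₀ (2 * R), u x ≤ M) →
      volume.real (ball x₀ R) ≤ 2 * volume.real (ball x₀ R ∩ {x | u x ≤ M - Ω}) →
      volume.real (ball x₀ R ∩ {x | M - Ω * (1 / 2) ^ N < u x}) ≤ θ * R ^ d := by
  obtain ⟨C, hC, hiso⟩ := measure_superlevel_mul_le d
  set v := volume.real (ball (0 : Rd d) 1) with hv
  have hv0 : 0 ≤ v := measureReal_nonneg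
  set J := 2 * K * 16 ^ (n + 2) * 2 ^ d * v with hJ
  have hJ0 : 0 ≤ J := by positivity
  -- `μ` weighs the energy against the measure of the level strips
  set μ := C * (J + 1) / θ with hμ
  have hμ0 : 0 < μ := by positivity
  obtain ⟨N, hN⟩ := exists_nat_gt (C * μ * v / θ)
  refine ⟨N, fun u A hA hu hcac x₀ R M Ω hR hR1 hΩ hAR hM hhalf => ?_⟩
  have huc := hu.continuous
  have hgu := continuous_gradient hu
  set a := volume.real (ball x₀ R ∩ {x | M - Ω * (1 / 2) ^ N < u x}) with ha
  set S : ℕ → Set (Rd d) := fun j => ball x₀ R ∩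
    {x | M - Ω * (1 / 2) ^ j < u x ∧ u x ≤ M - Ω * (1 / 2) ^ (j + 1)} with hS
  have hSm : ∀ j, MeasurableSet (S j) := fun j =>
    measurableSet_ball.inter ((isOpen_lt continuous_const huc).measurableSet.inter
      (isClosed_le huc continuous_const).measurableSet)
  have hSfin : ∀ j, volume (S j) ≠ ⊤ := fun j =>
    ((measure_mono Set.inter_subset_left).trans_lt measure_ball_lt_top).ne
  have half_anti : ∀ {i j : ℕ}, i ≤ j → ((1 : ℝ) / 2) ^ j ≤ (1 / 2) ^ i := fun h =>
    pow_le_pow_of_le_one (by norm_num) (by norm_num) h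
  have hstep : ∀ j < N, a ≤ C * J / (2 * μ) * R ^ d + C * μ / 2 * volume.real (S j) := by
    intro j hj
    set q := Ω * (1 / 2) ^ (j + 1) with hq
    have hq0 : 0 < q := by positivity
    have hkq : M - Ω * (1 / 2) ^ j = M - 2 * q := by rw [hq, pow_succ]; ring
    have hkq' : M - Ω * (1 / 2) ^ (j + 1) = M - q := rfl
    have hAq : A * R ^ 2 ≤ q := hAR.trans (by
      rw [hq]; exact mul_le_mul_of_nonneg_left (half_anti (by omega)) hΩ.le)
    have h1 := hiso u hu x₀ R (M - 2 * q) (M - q) hR (by linarith) (hhalf.trans (by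
      gcongr
      · exact ((measure_mono Set.inter_subset_left).trans_lt measure_ball_lt_top).ne
      · have : Ω * (1 / 2) ^ j ≤ Ω * 1 :=
          mul_le_mul_of_nonneg_left (pow_le_one₀ (by norm_num) (by norm_num)) hΩ.le
        linarith))
    have h2 := setIntegral_gradient_sq_superlevel_le hK hA hu hcac hR hR1 hq0 hAq hM
    rw [show M - q - (M - 2 * q) = q by ring] at h1
    have hSj : S j = ball x₀ R ∩ {x | M - 2 * q < u x ∧ u x ≤ M - q} := by
      simp only [hS, hkq, hkq']
    rw [← hSj] at h1
    have h3 : a ≤ volume.real (ball x₀ R ∩ {x | M - q < u x}) := by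
      refine measureReal_mono (fun x hx => ⟨hx.1, ?_⟩)
        ((measure_mono Set.inter_subset_left).trans_lt measure_ball_lt_top).ne
      have hx2 : M - Ω * (1 / 2) ^ N < u x := hx.2
      have : Ω * (1 / 2) ^ N ≤ q := mul_le_mul_of_nonneg_left (half_anti (by omega)) hΩ.le
      change M - q < u x
      linarith
    -- Young's inequality on the strip, with the weight scaling like a gradient
    have h4 : ∫ x in S j, ‖gradient u x‖ ≤
        R / (2 * μ * q) * (∫ x in ball x₀ R ∩ {x | M - 2 * q < u x}, ‖gradient u x‖ ^ 2) +
          μ * q / (2 * R) * volume.real (S j) := by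
      have hsub : S j ⊆ ball x₀ R := Set.inter_subset_left
      have i2 : IntegrableOn (fun x => ‖gradient u x‖ ^ 2) (S j) :=
        (Continuous.integrableOn_ball' (by fun_prop) x₀ R).mono_set hsub
      calc ∫ x in S j, ‖gradient u x‖ ≤
            ∫ x in S j, (R / (2 * μ * q) * ‖gradient u x‖ ^ 2 + μ * q / (2 * R)) := by
            refine setIntegral_mono_on ((Continuous.integrableOn_ball' (by fun_prop) x₀ R).mono_set
              hsub) ((i2.const_mul _).add (integrableOn_const (hSfin j))) (hSm j) fun x _ => ?_
            have e : R / (2 * μ * q) * ‖gradient u x‖ ^ 2 + μ * q / (2 * R) - ‖gradient u x‖ =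
                (R * ‖gradient u x‖ - μ * q) ^ 2 / (2 * μ * q * R) := by field_simp; ring
            have : 0 ≤ (R * ‖gradient u x‖ - μ * q) ^ 2 / (2 * μ * q * R) := by positivity
            linarith
        _ = R / (2 * μ * q) * (∫ x in S j, ‖gradient u x‖ ^ 2) +
              μ * q / (2 * R) * volume.real (S j) := by
            rw [integral_add (i2.const_mul _) (integrableOn_const (hSfin j)), integral_const_mul,
              setIntegral_const, smul_eq_mul]
            ring
        _ ≤ _ := by
            refine add_le_add (mul_le_mul_of_nonneg_left (setIntegral_mono_set
              ((Continuous.integrableOn_ball' (by fun_prop) x₀ R).mono_set Set.inter_subset_left)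
              (Filter.Eventually.of_forall fun x => by positivity) ?_) (by positivity)) le_rfl
            rw [hSj]
            exact LE.le.eventuallyLE fun x hx => ⟨hx.1, hx.2.1⟩
    set D := ∫ x in ball x₀ R ∩ {x | M - 2 * q < u x}, ‖gradient u x‖ ^ 2
    refine le_of_mul_le_mul_left ?_ hq0
    calc q * a ≤ q * volume.real (ball x₀ R ∩ {x | M - q < u x}) := by gcongr
      _ ≤ C * R * ∫ x in S j, ‖gradient u x‖ := h1
      _ ≤ C * R * (R / (2 * μ * q) * D + μ * q / (2 * R) * volume.real (S j)) := by gcongr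
      _ = C / (2 * μ * q) * (R ^ 2 * D) + q * (C * μ / 2 * volume.real (S j)) := by field_simp
      _ ≤ C / (2 * μ * q) * (J * q ^ 2 * R ^ d) + q * (C * μ / 2 * volume.real (S j)) := by gcongr
      _ = _ := by field_simp
  have hdisj : ∑ j ∈ Finset.range N, volume.real (S j) ≤ volume.real (ball x₀ R) := by
    rw [← measureReal_biUnion_finset]
    · exact measureReal_mono (Set.iUnion₂_subset fun j _ => Set.inter_subset_left)
        measure_ball_lt_top.ne
    · intro i _ j _ hij
      refine Set.disjoint_left.2 fun x hi hj => ?_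
      rcases lt_or_gt_of_ne hij with h | h
      · have h1 : u x ≤ M - Ω * (1 / 2) ^ (i + 1) := hi.2.2
        have h2 : M - Ω * (1 / 2) ^ j < u x := hj.2.1
        have := mul_le_mul_of_nonneg_left (half_anti (show i + 1 ≤ j by omega)) hΩ.le
        linarith
      · have h1 : u x ≤ M - Ω * (1 / 2) ^ (j + 1) := hj.2.2
        have h2 : M - Ω * (1 / 2) ^ i < u x := hi.2.1
        have := mul_le_mul_of_nonneg_left (half_anti (show j + 1 ≤ i by omega)) hΩ.le
        linarith
    · exact fun j _ => hSm j
  have hsum : N * a ≤ N * (C * J / (2 * μ) * R ^ d) + C * μ / 2 * (R ^ d * v) := by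
    calc (N : ℝ) * a = ∑ _j ∈ Finset.range N, a := by simp
      _ ≤ ∑ j ∈ Finset.range N, (C * J / (2 * μ) * R ^ d + C * μ / 2 * volume.real (S j)) :=
          Finset.sum_le_sum fun j hj => hstep j (Finset.mem_range.1 hj)
      _ = N * (C * J / (2 * μ) * R ^ d) + C * μ / 2 * ∑ j ∈ Finset.range N, volume.real (S j) := by
          rw [Finset.sum_add_distrib, Finset.mul_sum (f := fun j => volume.real (S j))]; simp
      _ ≤ _ := by
          gcongr
          exact hdisj.trans (measureReal_ball_eq x₀ hR).le
  have hNpos : (0 : ℝ) < N := lt_of_le_of_lt (by positivity) hN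
  have hRd : 0 < R ^ d := by positivity
  have b1 : C * J / (2 * μ) ≤ θ / 2 := by
    have e : C * J / (2 * μ) = θ / 2 * (J / (J + 1)) := by rw [hμ]; field_simp
    rw [e]
    exact mul_le_of_le_one_right (by positivity) ((div_le_one (by positivity)).2 (by linarith))
  have b2 : C * μ / 2 * v ≤ N * (θ / 2) := by
    rw [div_lt_iff₀ hθ] at hN
    linarith
  refine le_of_mul_le_mul_left ?_ hNpos
  calc N * a ≤ _ := hsum
    _ = N * (C * J / (2 * μ) * R ^ d) + C * μ / 2 * v * R ^ d := by ring
    _ ≤ N * (θ / 2 * R ^ d) + N * (θ / 2) * R ^ d := by gcongr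
    _ = _ := by ring

end ShrinkingLevelSets

/-! ### Decay of the oscillation -/

section Oscillation

variable {d : ℕ}

/-- The two lemmas of De Giorgi combined: if `u` is below `M - Ω` on half of a ball, then its upper
bound improves by a fixed fraction of `Ω` on the ball of half the radius. -/
theorem exists_upper_bound_decay (hd : 2 ≤ d) (n : ℕ) {K : ℝ} (hK : 0 ≤ K) :
    ∃ N : ℕ, ∀ (u : Rd d → ℝ) (A : ℝ), 0 ≤ A → ContDiff ℝ 1 u → SatisfiesCaccioppoli n K A u →
    ∀ (x₀ : Rd d) (R M Ω : ℝ), 0 < R → R ≤ 1 → 0 < Ω → A * R ^ 2 ≤ Ω * (1 / 2) ^ (N + 1) →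
      (∀ x ∈ ball x₀ (2 * R), u x ≤ M) →
      volume.real (ball x₀ R) ≤ 2 * volume.real (ball x₀ R ∩ {x | u x ≤ M - Ω}) →
      ∀ x ∈ ball x₀ (R / 2), u x ≤ M - Ω * (1 / 2) ^ (N + 1) := by
  obtain ⟨ε, hε, h1⟩ := exists_degiorgi_small_superlevel hd n hK
  obtain ⟨N, h2⟩ := exists_degiorgi_shrinking d n hK (show 0 < ε ^ d by positivity)
  refine ⟨N, fun u A hA hu hcac x₀ R M Ω hR hR1 hΩ hAR hM hhalf x hx => ?_⟩
  have e : Ω * (1 / 2) ^ N = 2 * (Ω * (1 / 2) ^ (N + 1)) := by rw [pow_succ]; ring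
  have hH : 0 < Ω * (1 / 2 : ℝ) ^ (N + 1) := by positivity
  have hsmall := h2 u A hA hu hcac x₀ R M Ω hR hR1 hΩ (by linarith) hM hhalf
  rw [← mul_pow] at hsmall
  have := h1 u A hA hu hcac x₀ R (M - Ω * (1 / 2) ^ N) (Ω * (1 / 2) ^ (N + 1)) hR (by linarith) hH
    hAR (fun y hy => by
      have := hM y (ball_subset_ball (by linarith) hy)
      linarith) hsmall x hx
  linarith

/-- The oscillation of `u` over the ball of radius `R` around `x₀` is at most `D`. -/
def OscLE (u : Rd d → ℝ) (x₀ : Rd d) (R D : ℝ) : Prop :=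
  ∃ m : ℝ, ∀ x ∈ ball x₀ R, m ≤ u x ∧ u x ≤ m + D

/-- The oscillation decays by a fixed factor `θ` when the radius is divided by four, unless it is
already of the order of the source term, `A R²`. -/
theorem exists_osc_decay (hd : 2 ≤ d) (n : ℕ) {K : ℝ} (hK : 0 ≤ K) :
    ∃ θ J : ℝ, 3 / 4 ≤ θ ∧ θ < 1 ∧ 0 ≤ J ∧
    ∀ (u : Rd d → ℝ) (A : ℝ), 0 ≤ A → ContDiff ℝ 1 u → SatisfiesCaccioppoli n K A u →
      SatisfiesCaccioppoli n K A (fun x => -u x) →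
    ∀ (x₀ : Rd d) (R D : ℝ), 0 < R → R ≤ 1 → 0 < D → J * A * R ^ 2 ≤ D →
      OscLE u x₀ (2 * R) D → OscLE u x₀ (R / 2) (θ * D) := by
  obtain ⟨N, hN⟩ := exists_upper_bound_decay hd n hK
  set σ : ℝ := (1 / 2) ^ (N + 2) with hσ
  have hσ0 : 0 < σ := by positivity
  have hσ4 : σ ≤ 1 / 4 := by
    have : (1 / 2 : ℝ) ^ N ≤ 1 := pow_le_one₀ (by norm_num) (by norm_num)
    rw [hσ, pow_add]; linarith
  refine ⟨1 - σ, σ⁻¹, by linarith, by linarith, by positivity,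
    fun u A hA hu hc1 hc2 x₀ R D hR hR1 hD hJ ⟨m, hm⟩ => ?_⟩
  have e : D / 2 * (1 / 2) ^ (N + 1) = σ * D := by rw [hσ, pow_succ _ (N + 1)]; ring
  have hAR : A * R ^ 2 ≤ D / 2 * (1 / 2) ^ (N + 1) := by
    rw [e]
    have := mul_le_mul_of_nonneg_left hJ hσ0.le
    rwa [mul_assoc, mul_inv_cancel_left₀ hσ0.ne'] at this
  have huc := hu.continuous
  have hsum : volume.real (ball x₀ R) =
      volume.real (ball x₀ R ∩ {x | u x ≤ m + D - D / 2}) +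
        volume.real (ball x₀ R \ {x | u x ≤ m + D - D / 2}) :=
    (measureReal_inter_add_sdiff (isClosed_le huc continuous_const).measurableSet
      measure_ball_lt_top.ne).symm
  have hsub : ball x₀ (R / 2) ⊆ ball x₀ (2 * R) := ball_subset_ball (by linarith)
  -- one of `u` and `-u` is below the middle value on half of the ball
  rcases le_total (volume.real (ball x₀ R \ {x | u x ≤ m + D - D / 2}))
    (volume.real (ball x₀ R ∩ {x | u x ≤ m + D - D / 2})) with hcase | hcase
  · have h := hN u A hA hu hc1 x₀ R (m + D) (D / 2) hR hR1 (by positivity) hAR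
      (fun x hx => (hm x hx).2) (by linarith)
    refine ⟨m, fun x hx => ⟨(hm x (hsub hx)).1, ?_⟩⟩
    have := h x hx
    rw [e] at this
    linarith
  · have hmono : volume.real (ball x₀ R \ {x | u x ≤ m + D - D / 2}) ≤
        volume.real (ball x₀ R ∩ {x | -u x ≤ -m - D / 2}) := by
      refine measureReal_mono (fun x hx => ⟨hx.1, ?_⟩)
        ((measure_mono Set.inter_subset_left).trans_lt measure_ball_lt_top).ne
      have h1 : ¬ u x ≤ m + D - D / 2 := hx.2
      change -u x ≤ -m - D / 2
      linarith
    have h := hN (fun x => -u x) A hA hu.neg hc2 x₀ R (-m) (D / 2) hR hR1 (by positivity) hAR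
      (fun x hx => by linarith [(hm x hx).1]) (by linarith)
    refine ⟨m + σ * D, fun x hx => ⟨?_, ?_⟩⟩
    · have := h x hx
      rw [e] at this
      linarith
    · linarith [(hm x (hsub hx)).2]

/-- Oscillation decay along the radii `4⁻ʲ` is Hölder continuity. -/
theorem exists_holderOnWith_of_caccioppoli (hd : 2 ≤ d) (n : ℕ) {K A : ℝ} (hK : 0 ≤ K)
    (M : ℝ) : ∃ α C : ℝ≥0, 0 < α ∧ α < 1 ∧
    ∀ u : Rd d → ℝ, 0 ≤ A → ContDiff ℝ 1 u → SatisfiesCaccioppoli n K A u →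
      SatisfiesCaccioppoli n K A (fun x => -u x) →
      ∀ x₀ : Rd d, (∀ x ∈ ball x₀ 2, |u x| ≤ M) → HolderOnWith C α u (ball x₀ 1) := by
  obtain ⟨θ, J, hθ, hθ1, hJ, hosc⟩ := exists_osc_decay hd n hK
  have hθ0 : 0 < θ := by linarith
  -- the exponent for which `(1 / 4) ^ α = θ`
  set α := Real.log θ / Real.log (1 / 4) with hα
  have hl4 : Real.log (1 / 4) < 0 := Real.log_neg (by norm_num) (by norm_num)
  have hα0 : 0 < α := div_pos_of_neg_of_neg (Real.log_neg hθ0 hθ1) hl4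
  have hα1 : α < 1 := by
    rw [hα, div_lt_one_of_neg hl4]
    exact Real.log_lt_log (by norm_num) (by linarith)
  have h4α : (1 / 4 : ℝ) ^ α = θ := by
    rw [Real.rpow_def_of_pos (by norm_num), hα, mul_div_cancel₀ _ hl4.ne, Real.exp_log hθ0]
  set D := 2 * M + J * A + 1 with hD_def
  refine ⟨α.toNNReal, (D / θ ^ 2).toNNReal, Real.toNNReal_pos.2 hα0,
    Real.toNNReal_lt_one.2 hα1, fun u hA hu hc1 hc2 x₀ hM => ?_⟩
  have hM0 : 0 ≤ M := (abs_nonneg _).trans (hM x₀ (mem_ball_self (by norm_num)))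
  have hD : 0 < D := by positivity
  have hJA : 0 ≤ J * A := mul_nonneg hJ hA
  have hdecay : ∀ x ∈ ball x₀ 1, ∀ j : ℕ, OscLE u x ((1 / 4) ^ j) (D * θ ^ j) := fun x hx j => by
    induction j with
    | zero =>
      refine ⟨-M, fun y hy => ?_⟩
      have hy2 : y ∈ ball x₀ 2 := by
        rw [mem_ball] at hx hy ⊢
        rw [pow_zero] at hy
        linarith [dist_triangle y x x₀]
      have := abs_le.1 (hM y hy2)
      rw [pow_zero, mul_one]
      exact ⟨this.1, by linarith [this.2]⟩
    | succ j ih =>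
      have h4 : (1 / 4 : ℝ) ^ j ≤ 1 := pow_le_one₀ (by norm_num) (by norm_num)
      have h40 : (0 : ℝ) < (1 / 4) ^ j := by positivity
      have h4θ : (1 / 4 : ℝ) ^ j ≤ θ ^ j := pow_le_pow_left₀ (by norm_num) (by linarith) j
      have := hosc u A hA hu hc1 hc2 x ((1 / 4) ^ j / 2) (D * θ ^ j) (by positivity)
        (by linarith) (by positivity) (by
          calc J * A * ((1 / 4) ^ j / 2) ^ 2 = J * A * (1 / 4 * (1 / 4) ^ j * (1 / 4) ^ j) := by ring
            _ ≤ J * A * (1 * 1 * θ ^ j) := by gcongr; norm_num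
            _ = J * A * θ ^ j := by ring
            _ ≤ D * θ ^ j := by gcongr; linarith)
        (by rwa [mul_div_cancel₀ _ (two_ne_zero' ℝ)])
      rwa [show θ * (D * θ ^ j) = D * θ ^ (j + 1) by ring,
        show (1 / 4 : ℝ) ^ j / 2 / 2 = (1 / 4) ^ (j + 1) by ring] at this
  have hreal : ∀ x ∈ ball x₀ 1, ∀ y ∈ ball x₀ 1, dist (u x) (u y) ≤ D / θ ^ 2 * dist x y ^ α := by
    intro x hx y hy
    have hle : ∀ z ∈ ball x₀ 1, |u z| ≤ M := fun z hz => hM z (ball_subset_ball (by norm_num) hz)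
    have h2M : dist (u x) (u y) ≤ D := by
      rw [Real.dist_eq]
      have := abs_sub (u x) (u y)
      linarith [hle x hx, hle y hy]
    have hDθ : D ≤ D / θ ^ 2 := by
      rw [le_div_iff₀ (by positivity)]
      exact mul_le_of_le_one_right hD.le (pow_le_one₀ hθ0.le hθ1.le)
    rcases eq_or_lt_of_le (dist_nonneg (x := x) (y := y)) with h0 | h0
    · have : x = y := dist_eq_zero.1 h0.symm
      rw [this, dist_self]; positivity
    rcases le_or_gt 1 (dist x y) with h1 | h1
    · refine h2M.trans (hDθ.trans (le_mul_of_one_le_right (by positivity) ?_))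
      exact Real.one_le_rpow h1 hα0.le
    obtain ⟨j, hj1, hj2⟩ := exists_nat_pow_near_of_lt_one h0 h1.le (show (0 : ℝ) < 1 / 4 by norm_num)
      (by norm_num)
    have hlow : θ ^ (j + 1) ≤ dist x y ^ α := by
      calc θ ^ (j + 1) = ((1 / 4 : ℝ) ^ (j + 1)) ^ α := by
            rw [← h4α, ← Real.rpow_natCast, ← Real.rpow_natCast, ← Real.rpow_mul (by norm_num),
              ← Real.rpow_mul (by norm_num), mul_comm]
        _ ≤ _ := Real.rpow_le_rpow (by positivity) hj1.le hα0.le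
    -- `y` lies in the open ball of radius `4 ^ -(j - 1)` around `x`
    have hup : dist (u x) (u y) ≤ D / θ ^ 2 * θ ^ (j + 1) := by
      rcases j with _ | j
      · refine h2M.trans ?_
        rw [zero_add, pow_one, div_mul_eq_mul_div, le_div_iff₀ (by positivity)]
        gcongr
        rw [sq]
        exact mul_le_of_le_one_right hθ0.le hθ1.le
      · obtain ⟨m, hm⟩ := hdecay x hx j
        have hx1 := hm x (mem_ball_self (by positivity))
        have hy1 := hm y (by
          rw [mem_ball, dist_comm]
          refine hj2.trans_lt ?_
          rw [pow_succ]
          have : (0 : ℝ) < (1 / 4) ^ j := by positivity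
          linarith)
        rw [show D / θ ^ 2 * θ ^ (j + 1 + 1) = D * θ ^ j by
          rw [pow_add, pow_add]; field_simp]
        rw [Real.dist_eq, abs_le]
        constructor <;> linarith [hx1.1, hx1.2, hy1.1, hy1.2]
    exact hup.trans (mul_le_mul_of_nonneg_left hlow (by positivity))
  intro x hx y hy
  rw [edist_dist, edist_dist, Real.coe_toNNReal α hα0.le, ENNReal.ofReal_rpow_of_nonneg dist_nonneg hα0.le,
    ← ENNReal.ofReal_coe_nnreal, Real.coe_toNNReal _ (by positivity),
    ← ENNReal.ofReal_mul (by positivity)]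
  exact ENNReal.ofReal_le_ofReal (hreal x hx y hy)

end Oscillation

/-! ### The maximum principle -/

section MaximumPrinciple

variable {d : ℕ}

theorem deriv_deriv_nonpos_of_isLocalMax {φ : ℝ → ℝ} {t : ℝ} (h : IsLocalMax φ t)
    (hc : ContinuousAt φ t) : deriv (deriv φ) t ≤ 0 := by
  by_contra! hpos
  have hmin := isLocalMin_of_deriv_deriv_pos hpos h.deriv_eq_zero hc
  have heq : φ =ᶠ[nhds t] fun _ => φ t := by
    filter_upwards [h, hmin] with s h1 h2 using le_antisymm h1 h2
  have : deriv φ =ᶠ[nhds t] fun _ => 0 := by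
    have h2 := heq.deriv
    simpa using h2
  rw [this.deriv_eq] at hpos
  simp at hpos

/-- First and second order conditions at a maximum point of `u - ε ‖·‖²`. -/
theorem gradient_laplacian_at_max {u : Rd d → ℝ} (hu : ContDiff ℝ 2 u) {ε : ℝ} {z : Rd d}
    (hz : ∀ x, u x - ε * ‖x‖ ^ 2 ≤ u z - ε * ‖z‖ ^ 2) :
    gradient u z = (2 * ε) • z ∧ Laplacian.laplacian u z ≤ 2 * ε * d := by
  have hD1 : Differentiable ℝ u := hu.differentiable (by norm_num)
  have hD2 : Differentiable ℝ (fderiv ℝ u) :=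
    (hu.fderiv_right (m := 1) (by norm_num)).differentiable (by norm_num)
  have main : ∀ i : Fin d, fderiv ℝ u z (EuclideanSpace.single i 1) = 2 * ε * z i ∧
      fderiv ℝ (fderiv ℝ u) z (EuclideanSpace.single i 1) (EuclideanSpace.single i 1) ≤ 2 * ε := by
    intro i
    set e : Rd d := EuclideanSpace.single i 1 with he
    have hzi : inner ℝ z e = z i := by rw [he, EuclideanSpace.inner_single_right]; simp
    have hene : ‖e‖ = 1 := by rw [he]; simp
    set φ : ℝ → ℝ := fun t => u (z + t • e) - ε * (‖z‖ ^ 2 + 2 * t * z i + t ^ 2) with hφ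
    have hφeq : ∀ t, φ t = u (z + t • e) - ε * ‖z + t • e‖ ^ 2 := fun t => by
      rw [hφ, norm_add_sq_real, inner_smul_right, hzi, norm_smul, hene, mul_one,
        Real.norm_eq_abs, sq_abs]
      ring
    have hline : ∀ t : ℝ, HasDerivAt (fun t : ℝ => z + t • e) e t := fun t => by
      simpa using ((hasDerivAt_id t).smul_const e).const_add z
    have hd1 : ∀ t, HasDerivAt φ (fderiv ℝ u (z + t • e) e - ε * (2 * z i + 2 * t)) t := fun t => by
      have h1 := (hD1 (z + t • e)).hasFDerivAt.comp_hasDerivAt t (hline t)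
      have h2 : HasDerivAt (fun t : ℝ => ε * (‖z‖ ^ 2 + 2 * t * z i + t ^ 2))
          (ε * (2 * z i + 2 * t)) t := by
        have := ((((hasDerivAt_id t).const_mul 2).mul_const (z i)).const_add (‖z‖ ^ 2)).add
          (hasDerivAt_pow 2 t)
        refine (this.const_mul ε).congr_deriv ?_
        simp
      exact h1.sub h2
    have hmax : IsLocalMax φ 0 := Filter.Eventually.of_forall fun t => by
      rw [hφeq, hφeq]
      simpa using hz (z + t • e)
    have hd2 : HasDerivAt (deriv φ) (fderiv ℝ (fderiv ℝ u) z e e - ε * 2) 0 := by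
      rw [funext fun t => (hd1 t).deriv]
      have h0 : HasFDerivAt (fderiv ℝ u) (fderiv ℝ (fderiv ℝ u) z) (z + (0 : ℝ) • e) := by
        rw [zero_smul, add_zero]; exact (hD2 z).hasFDerivAt
      have h1 : HasDerivAt (fun t : ℝ => fderiv ℝ u (z + t • e)) (fderiv ℝ (fderiv ℝ u) z e) 0 :=
        h0.comp_hasDerivAt (0 : ℝ) (hline 0)
      have h2 := h1.clm_apply (hasDerivAt_const (0 : ℝ) e)
      have h3 : HasDerivAt (fun t : ℝ => ε * (2 * z i + 2 * t)) (ε * 2) 0 := by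
        simpa using (((hasDerivAt_id (0 : ℝ)).const_mul 2).const_add (2 * z i)).const_mul ε
      refine (h2.sub h3).congr_deriv ?_
      simp
    have c1 := hmax.deriv_eq_zero
    rw [(hd1 0).deriv] at c1
    have c2 := deriv_deriv_nonpos_of_isLocalMax hmax (hd1 0).continuousAt
    rw [hd2.deriv] at c2
    simp only [zero_smul, add_zero, mul_zero] at c1
    exact ⟨by linarith, by linarith⟩
  refine ⟨?_, ?_⟩
  · ext i
    rw [gradient_apply_eq, (main i).1]
    simp
  · rw [InnerProductSpace.laplacian_eq_iteratedFDeriv_orthonormalBasis u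
      (EuclideanSpace.basisFun (Fin d) ℝ)]
    calc _ ≤ ∑ _i : Fin d, 2 * ε := by
          refine Finset.sum_le_sum fun i _ => ?_
          rw [iteratedFDeriv_two_apply]
          simpa using (main i).2
      _ = _ := by simp [mul_comm]

/-- The maximum principle on the whole space, for bounded solutions and bounded drifts. -/
theorem mul_le_of_bounded {lam A B M : ℝ} {b : Rd d → Rd d} {u : Rd d → ℝ} (hlam : 0 < lam)
    (hu : ContDiff ℝ 2 u) (hb : ∀ x, ‖b x‖ ≤ B) (hM : ∀ x, |u x| ≤ M)
    (heq : ∀ x, lam * u x + driftSource b u x ≤ A) (y : Rd d) : lam * u y ≤ A := by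
  have hM0 : 0 ≤ M := (abs_nonneg _).trans (hM 0)
  have hB0 : 0 ≤ B := (norm_nonneg _).trans (hb 0)
  -- maximize `u - t² ‖·‖²` and let `t` tend to zero
  have hpos : ∀ t : ℝ, 0 < t →
      lam * (u y - t ^ 2 * ‖y‖ ^ 2) ≤ A + 2 * t ^ 2 * d + B * (2 * t * √(2 * M)) := by
    intro t ht
    have hcont : Continuous fun x => -(u x - t ^ 2 * ‖x‖ ^ 2) := by
      have := hu.continuous
      fun_prop
    obtain ⟨z, hz⟩ : ∃ z, ∀ x, u x - t ^ 2 * ‖x‖ ^ 2 ≤ u z - t ^ 2 * ‖z‖ ^ 2 := by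
      have hfar : ∀ᶠ x in Filter.cocompact (Rd d),
          -(u 0 - t ^ 2 * ‖(0 : Rd d)‖ ^ 2) ≤ -(u x - t ^ 2 * ‖x‖ ^ 2) := by
        have hc : (closedBall (0 : Rd d) (√(2 * M) / t))ᶜ ∈ Filter.cocompact (Rd d) :=
          (isCompact_closedBall _ _).compl_mem_cocompact
        filter_upwards [hc] with x hx
        rw [Set.mem_compl_iff, mem_closedBall_zero_iff, not_le, div_lt_iff₀ ht] at hx
        have h1 : 2 * M ≤ (‖x‖ * t) ^ 2 := by
          rw [← Real.sq_sqrt (show 0 ≤ 2 * M by linarith)]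
          gcongr
        have h2 := abs_le.1 (hM x)
        have h3 := abs_le.1 (hM 0)
        rw [norm_zero]
        nlinarith
      obtain ⟨z, hz⟩ := hcont.exists_forall_le' 0 hfar
      exact ⟨z, fun x => by linarith [hz x]⟩
    obtain ⟨hg, hΔ⟩ := gradient_laplacian_at_max hu hz
    have hz0 := hz 0
    rw [norm_zero] at hz0
    have h2 := abs_le.1 (hM z)
    have h3 := abs_le.1 (hM 0)
    have htz : t * ‖z‖ ≤ √(2 * M) := Real.le_sqrt_of_sq_le (by nlinarith)
    have hinner : -(B * (2 * t * √(2 * M))) ≤ inner ℝ (b z) (gradient u z) := by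
      have h4 := neg_le_of_abs_le (abs_real_inner_le_norm (b z) (gradient u z))
      rw [hg, norm_smul, Real.norm_of_nonneg (by positivity)] at h4
      rw [hg]
      refine le_trans (neg_le_neg ?_) h4
      calc ‖b z‖ * (2 * t ^ 2 * ‖z‖) = ‖b z‖ * (2 * t * (t * ‖z‖)) := by ring
        _ ≤ _ := by gcongr; exact hb z
    have h5 := heq z
    rw [driftSource] at h5
    have h6 := mul_le_mul_of_nonneg_left (hz y) hlam.le
    have h7 : 0 ≤ lam * (t ^ 2 * ‖z‖ ^ 2) := by positivity
    linarith
  have hl : Filter.Tendsto (fun t : ℝ => lam * (u y - t ^ 2 * ‖y‖ ^ 2)) (nhdsWithin 0 (Set.Ioi 0))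
      (nhds (lam * (u y - 0 ^ 2 * ‖y‖ ^ 2))) :=
    (Continuous.tendsto (by fun_prop) 0).mono_left nhdsWithin_le_nhds
  have hr : Filter.Tendsto (fun t : ℝ => A + 2 * t ^ 2 * d + B * (2 * t * √(2 * M)))
      (nhdsWithin 0 (Set.Ioi 0)) (nhds (A + 2 * 0 ^ 2 * d + B * (2 * 0 * √(2 * M)))) :=
    (Continuous.tendsto (by fun_prop) 0).mono_left nhdsWithin_le_nhds
  have := le_of_tendsto_of_tendsto hl hr
    (Filter.eventually_of_mem self_mem_nhdsWithin fun t ht => hpos t ht)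
  simpa using this

end MaximumPrinciple

/-! ### Hölder estimates with generic constants -/

section Conclusion

variable {d : ℕ}

theorem driftSource_neg (b : Rd d → Rd d) (u : Rd d → ℝ) (x : Rd d) :
    driftSource b (fun y => -u y) x = -driftSource b u x := by
  have h1 : gradient (fun y => -u y) x = -gradient u x := by
    simp only [gradient]
    rw [fderiv_fun_neg, map_neg]
  have h2 : Laplacian.laplacian (fun y => -u y) x = -Laplacian.laplacian u x :=
    congrFun (InnerProductSpace.laplacian_neg (f := u)) x
  rw [driftSource, driftSource, h1, h2, inner_neg_right]
  ring

/-- A Caccioppoli inequality with uniform constants yields the Hölder estimates with generic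
constants. -/
theorem holderWithGenericConstants_of_caccioppoli (hd : 2 ≤ d) {lam A : ℝ}
    {P : (Rd d → Rd d) → Prop} (h : ∃ (n : ℕ) (K : ℝ), 0 ≤ K ∧ ∀ (b : Rd d → Rd d) (u : Rd d → ℝ)
      (A : ℝ), IsBoundedSmooth b → P b → ContDiff ℝ 2 u → (∀ x, |driftSource b u x| ≤ A) →
        SatisfiesCaccioppoli n K A u) :
    HolderWithGenericConstants d lam A P := by
  obtain ⟨n, K, hK, hcac⟩ := h
  have both : ∀ (b : Rd d → Rd d) (u : Rd d → ℝ) (A : ℝ), IsBoundedSmooth b → P b →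
      ContDiff ℝ 2 u → (∀ x, |driftSource b u x| ≤ A) →
      SatisfiesCaccioppoli n K A u ∧ SatisfiesCaccioppoli n K A (fun x => -u x) :=
    fun b u A hb hP hu hA => ⟨hcac b u A hb hP hu hA, hcac b _ A hb hP hu.neg fun x => by
      rw [driftSource_neg, abs_neg]; exact hA x⟩
  refine ⟨fun hlam => ?_, fun hlam M => ?_⟩
  · obtain ⟨α, C, hα0, hα1, hH⟩ :=
      exists_holderOnWith_of_caccioppoli hd n (A := 2 * A) hK (A / lam)
    refine ⟨α, C, hα0, hα1, fun b f u hb hP hf hfA hsol hbdd x₀ => ?_⟩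
    obtain ⟨M, hM⟩ := hbdd
    obtain ⟨B, hB⟩ := hb.2
    have hA0 : 0 ≤ A := (abs_nonneg _).trans (hfA 0)
    have heq : ∀ x, lam * u x + driftSource b u x = f x := fun x => by
      rw [← hsol.2 x, driftSource]; ring
    have hup : ∀ x, lam * u x ≤ A := mul_le_of_bounded hlam hsol.1 hB hM fun x => by
      rw [heq]; exact (abs_le.1 (hfA x)).2
    have hlow : ∀ x, lam * -u x ≤ A := mul_le_of_bounded hlam hsol.1.neg hB
      (fun x => by rw [abs_neg]; exact hM x) fun x => by
        rw [driftSource_neg]; linarith [heq x, (abs_le.1 (hfA x)).1]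
    have hsrc : ∀ x, |driftSource b u x| ≤ 2 * A := fun x => by
      have h1 := abs_le.1 (hfA x)
      rw [abs_le]
      constructor <;> linarith [heq x, hup x, hlow x, h1.1, h1.2]
    obtain ⟨h1, h2⟩ := both b u (2 * A) hb hP hsol.1 hsrc
    refine hH u (by positivity) (hsol.1.of_le (by norm_num)) h1 h2 x₀ fun x _ => ?_
    rw [le_div_iff₀ hlam]
    rcases abs_choice (u x) with h | h <;> rw [h] <;> linarith [hup x, hlow x]
  · obtain ⟨α, C, hα0, hα1, hH⟩ := exists_holderOnWith_of_caccioppoli hd n (A := A) hK M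
    refine ⟨α, C, hα0, hα1, fun b f u hb hP hf hfA hsol x₀ hM => ?_⟩
    have hsrc : ∀ x, |driftSource b u x| ≤ A := fun x => by
      have e : driftSource b u x = f x := by
        rw [← hsol.2 x, driftSource, hlam]; ring
      rw [e]; exact hfA x
    obtain ⟨h1, h2⟩ := both b u A hb hP hsol.1 hsrc
    exact hH u ((abs_nonneg _).trans (hfA 0)) (hsol.1.of_le (by norm_num)) h1 h2 x₀ hM

end Conclusion

theorem theorem5p1 (d : ℕ) (hd : 3 ≤ d) (lam : ℝ) (hlam : 0 ≤ lam) (A : ℝ) :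
    (∀ δ c : ℝ, δ < 4 →
      HolderWithGenericConstants d lam A (fun b => IsFormBounded δ c b)) ∧
    (∀ κ c δp cp : ℝ, δp < 4 →
      HolderWithGenericConstants d lam A
        (fun b => IsMulFormBounded κ c b ∧ HasFormBoundedDivPlus δp cp b)) := by
  refine ⟨fun δ c hδ => ?_, fun κ c δp cp hδ => ?_⟩
  · obtain ⟨n, K, hK, h⟩ := caccioppoli_of_isFormBounded d (c := c) hδ
    exact holderWithGenericConstants_of_caccioppoli (by omega) ⟨n, K, hK,
      fun b u A hb hP hu hA => h b u A hb.1.continuous hP hu hA⟩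
  · obtain ⟨n, K, hK, h⟩ := caccioppoli_of_divergence d (κ := κ) (c := c) (cp := cp) hδ
    exact holderWithGenericConstants_of_caccioppoli (by omega) ⟨n, K, hK,
      fun b u A hb hP hu hA =>
        h b u A (hb.1.of_le (by exact_mod_cast le_top)) hP.1 hP.2 hu hA⟩
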